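/- For $n\ge 2$ and $W\ge 1$ let $\mathcal G(n,W)$ be the family of connected (simple, undirected) $n$-node graphs whose edges carry positive integral capacities at most $W$. For two vertices $u\neq v$ of $G\in\mathcal G(n,W)$, let $\mathrm{flow}_G(u,v)$ be the maximum number of pairwise edge-disjoint paths between $u$ and $v$ in the multigraph obtained from $G$ by replacing every edge $e$ of capacity $\omega(e)$ with $\omega(e)$ parallel edges. A *1-query flow labeling scheme* on $\mathcal G(n,W)$ consists of: a marker $\mathcal M$ that assigns to each vertex $v$ of each $G\in\mathcal G(n,W)$ a label $\mathcal M(v)=\langle \mathcal M^{index}(v),\mathcal M^{data}(v)\rangle$ composed of two bit strings, such that distinct vertices of $G$ have distinct index sublabels; a polynomial-time query algorithm $Q$ that, given the labels $\mathcal M(u),\mathcal M(v)$ of two distinct vertices of a graph $G\in\mathcal G(n,W)$, outputs $\mathcal M^{index}(w)$ for some vertex $w$ of $G$; and a polynomial-time decoder $\mathcal D$ that, given $\mathcal M(u)$, $\mathcal M(v)$ and $\mathcal M(w)$, outputs $\mathrm{flow}_G(u,v)$. Its *label size* is the maximum number of bits in a label, over all vertices of all graphs in $\mathcal G(n,W)$.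 **Lemma.** The optimal label size of a 1-query flow labeling scheme on $\mathcal G(n,W)$ is $\Theta(\log n+\log W)$. More precisely: (i) There are polynomial-time algorithms $Q$ and $\mathcal D$, independent of $n$ and $W$, and a constant $C>0$ such that for all $n\ge 2$ and $W\ge 1$ some 1-query flow labeling scheme on $\mathcal G(n,W)$ with query algorithm $Q$ and decoder $\mathcal D$ has label size at most $C(\log n+\log W)$. (ii) There is a constant $c>0$ such that for all $n\ge 2$ and $W\ge 1$ every 1-query flow labeling scheme on $\mathcal G(n,W)$, even one whose query function and decoder depend on $n$ and $W$ and are not required to be polynomial-time, has label size at least $c(\log n+\log W)$. -/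

import Mathlib

namespace FlowLabeling

/-! ### Capacitated graphs and the flow function -/

/-- A connected simple graph on the vertex set `V` whose edges carry positive integral capacities
bounded from above by `W`. Non-edges are given capacity `0`, so that the capacity function
carries no information beyond the capacities of the edges. -/
structure CapGraph (V : Type*) (W : ℕ) where
  graph : SimpleGraph V
  connected : graph.Connected
  cap : Sym2 V → ℕ
  cap_pos_iff : ∀ e, 0 < cap e ↔ e ∈ graph.edgeSet
  cap_le : ∀ e, cap e ≤ W

namespace CapGraph

variable {V : Type*} {W : ℕ} (G : CapGraph V W)

/-- The edges of the multigraph `G'` obtained from `G` by replacing each edge `e` with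
`G.cap e` parallel edges of unit capacity. -/
abbrev UnitEdge : Type _ := Σ e : Sym2 V, Fin (G.cap e)

/-- A path from `u` to `v` in the multigraph `G'`: a path of `G` together with the choice,
for each of its edges, of one of the parallel copies of that edge. -/
structure UnitPath (u v : V) where
  path : G.graph.Path u v
  copy : ∀ e : Sym2 V, e ∈ path.1.edges → Fin (G.cap e)

variable {G}

/-- The set of edges of `G'` used by a path of `G'`. -/
def UnitPath.edges {u v : V} (p : G.UnitPath u v) : Set G.UnitEdge :=
  {x | ∃ h : x.1 ∈ p.path.1.edges, p.copy x.1 h = x.2}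

variable (G)

/-- The possible cardinalities of sets of pairwise edge-disjoint paths of `G'`
between `u` and `v`. -/
def disjointPathCounts (u v : V) : Set ℕ :=
  {k | ∃ P : Finset (G.UnitPath u v),
    (P : Set (G.UnitPath u v)).PairwiseDisjoint UnitPath.edges ∧ P.card = k}

/-- The maximum flow between `u` and `v`: the maximum number of pairwise edge-disjoint paths
of `G'` between `u` and `v`. -/
noncomputable def flow (u v : V) : ℕ := sSup (G.disjointPathCounts u v)

instance [Finite V] (u v : V) : Finite (G.UnitPath u v) := by
  classical
  cases nonempty_fintype V
  have : Finite (G.graph.Path u v) := Finite.of_fintype _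
  have key : Function.Injective
      (fun p : G.UnitPath u v =>
        (⟨p.path, fun e => p.copy e.1 e.2⟩ :
          Σ q : G.graph.Path u v, ∀ e : {e : Sym2 V // e ∈ q.1.edges}, Fin (G.cap e.1))) := by
    rintro ⟨p, c⟩ ⟨q, d⟩ h
    simp only [Sigma.mk.injEq] at h
    obtain ⟨rfl, h⟩ := h
    have h' := eq_of_heq h
    congr 1
    funext e he
    exact congrFun h' ⟨e, he⟩
  exact Finite.of_injective _ key

/-- The supremum defining the flow is an attained maximum. -/
theorem isGreatest_flow [Finite V] (u v : V) :
    IsGreatest (G.disjointPathCounts u v) (G.flow u v) := by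
  have hb : BddAbove (G.disjointPathCounts u v) := by
    cases nonempty_fintype (G.UnitPath u v)
    refine ⟨Fintype.card (G.UnitPath u v), ?_⟩
    rintro k ⟨P, -, rfl⟩
    exact Finset.card_le_univ P
  exact ⟨Nat.sSup_mem ⟨0, ∅, by simp, rfl⟩ hb, fun k hk => le_csSup hb hk⟩

end CapGraph

/-- The family of connected `n`-node graphs with positive integral capacities at most `W`. -/
abbrev Family (n W : ℕ) : Type := CapGraph (Fin n) W

instance (n W : ℕ) : Finite (Family n W) := by
  have key : Function.Injective
      (fun G : Family n W => fun e => (⟨G.cap e, Nat.lt_succ_of_le (G.cap_le e)⟩ : Fin (W + 1))) := by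
    rintro ⟨g, hg, c, hc, hW⟩ ⟨g', hg', c', hc', hW'⟩ h
    have hcc : c = c' := by
      funext e
      exact congrArg Fin.val (congrFun h e)
    subst hcc
    have : g = g' := by
      rw [← SimpleGraph.edgeSet_inj]
      ext e
      rw [← hc, ← hc']
    subst this
    rfl
  exact Finite.of_injective _ key

/-! ### One-query labeling schemes -/

/-- A label, composed of an index sublabel and a data sublabel. -/
structure Label where
  index : List Bool
  data : List Bool

/-- The number of bits of a label. -/
def Label.size (L : Label) : ℕ := L.index.length + L.data.length

/-- A one-query labeling scheme on the family of connected `n`-node graphs with capacities at most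
`W`, supporting a function `f` on pairs of distinct vertices. Index sublabels are unique in each
graph; from the labels of `u` and `v`, the query algorithm computes the index of a vertex `w`
of the graph; and the decoder computes `f u v` from the labels of `u`, `v` and `w`. -/
structure OneQueryScheme (n W : ℕ) (f : Family n W → Fin n → Fin n → ℕ) where
  marker : Family n W → Fin n → Label
  query : Label → Label → List Bool
  decoder : Label → Label → Label → ℕ
  index_injective : ∀ G, Function.Injective fun v => (marker G v).index
  correct : ∀ G u v, u ≠ v → ∃ w,
    (marker G w).index = query (marker G u) (marker G v) ∧
    decoder (marker G u) (marker G v) (marker G w) = f G u v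

/-- The label size of a scheme: the maximum number of bits of a label, over all vertices of all
graphs of the family. -/
noncomputable def OneQueryScheme.labelSize {n W : ℕ} {f : Family n W → Fin n → Fin n → ℕ}
    (S : OneQueryScheme n W f) : ℕ :=
  ⨆ p : Family n W × Fin n, (S.marker p.1 p.2).size

/-- The supremum defining the label size is over a finite, hence bounded, set. -/
theorem OneQueryScheme.size_le_labelSize {n W : ℕ} {f : Family n W → Fin n → Fin n → ℕ}
    (S : OneQueryScheme n W f) (G : Family n W) (v : Fin n) :
    (S.marker G v).size ≤ S.labelSize :=
  le_ciSup (f := fun p : Family n W × Fin n => (S.marker p.1 p.2).size)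
    (Set.finite_range _).bddAbove (G, v)

/-- One-query flow labeling schemes. -/
abbrev FlowScheme (n W : ℕ) : Type := OneQueryScheme n W fun G u v => G.flow u v

/-! ### Polynomial time query and decoder algorithms -/

/-- A list of labels as an input string: every sublabel is followed by the separator `none`. -/
def encodeLabels (l : List Label) : List (Option Bool) :=
  l.flatMap fun L => L.index.map some ++ [none] ++ (L.data.map some ++ [none])

/-- The query algorithm can be run by a Turing machine in time polynomial in the total length of
the two labels given to it. -/
def PolyTimeQuery (Q : Label → Label → List Bool) : Prop :=
  Nonempty (Turing.TM2ComputableInPolyTime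
    (fun p : Label × Label => encodeLabels [p.1, p.2]) (fun s : List Bool => s)
    (fun p => Q p.1 p.2))

/-- The decoder algorithm can be run by a Turing machine in time polynomial in the total length of
the three labels given to it; its output is written in binary. -/
def PolyTimeDecoder (D : Label → Label → Label → ℕ) : Prop :=
  Nonempty (Turing.TM2ComputableInPolyTime
    (fun p : Label × Label × Label => encodeLabels [p.1, p.2.1, p.2.2]) Computability.encodeNat
    (fun p => D p.1 p.2.1 p.2.2))

end FlowLabeling

/-! For distinct vertices the flow is a similarity: it is symmetric and satisfies flow(u,v) ≥
min(flow(u,x), flow(x,v)). The usual proof uses minimum cuts. Here, given k edge-disjoint walks from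
u to x and k from v to x, k edge-disjoint walks from u to v are built by a stable matching. Shared
edges are ordered by their position along the walks. A kernel of the two orders (`exists_kernel`,
the Gale–Shapley theorem in fixed-point form) says at which shared edge to switch from one family to
the other, so that no other shared edge is used twice (`exists_disjoint_linked_trans`).

A similarity amounts to a hierarchy of splits with constant flow across each split. Following the
larger part at every split gives a heavy path ending at a vertex x, with light parts hanging off it,
each of at most half the size. For u in an earlier part and v in a later one, f u v = f u x, so one
value per light part answers all such pairs. It is stored at the vertex y ending the heavy path of
that part. Inside the part no pair needs y as its meeting vertex, so every vertex stores a single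
value.

Positions on a heavy path are named by a weight-balanced search tree over the letters L, M, R, and
the names are concatenated along the recursion. Balancing makes the lengths telescope to 4 log₂ n
(`IsSimilarity.exists_addressing`). From two addresses the query computes that of the vertex storing
the flow (`meet`), and the decoder merely reads the stored number. Explicit stack machines do both
in linear time.

For the lower bound, distinct indices force log n bits. On stars with uniform capacity 1, ..., W the
three labels seen by the decoder determine the capacity, which forces a constant multiple of log W
bits. -/

namespace FlowLabeling

/-! ### Edge-disjoint linking sets in a multigraph -/

/-- Two strict orders on a finite type have a common kernel: a set that is independent for both
orders and dominates every element outside of it. -/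
theorem exists_kernel {E : Type*} [Finite E] (r s : E → E → Prop) [IsTrans E r] [Std.Irrefl r]
    [IsTrans E s] [Std.Irrefl s] :
    ∃ M : Set E, (∀ a ∈ M, ∀ b ∈ M, ¬ r a b ∧ ¬ s a b) ∧
      ∀ e ∉ M, ∃ a ∈ M, r a e ∨ s a e := by
  let rej (t : E → E → Prop) (X : Set E) : Set E := {e | e ∈ X ∧ ∃ a ∈ X, t a e}
  have rej_mono : ∀ t, Monotone (rej t) := fun t X Y h e he =>
    ⟨h he.1, he.2.imp fun a ha => ⟨h ha.1, ha.2⟩⟩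
  -- A t-minimal dominator of e is itself not rejected: anything in X dominating it would, by
  -- transitivity, be a smaller dominator of e.
  have minimal : ∀ (t : E → E → Prop) [IsTrans E t] [Std.Irrefl t] (X : Set E) (e : E),
      e ∈ rej t X → ∃ a ∈ X, a ∉ rej t X ∧ t a e := by
    intro t _ _ X e he
    have wf : WellFounded t := Finite.wellFounded_of_trans_of_irrefl t
    obtain ⟨a, ⟨haX, hae⟩, hmin⟩ := wf.has_min {a | a ∈ X ∧ t a e} he.2
    refine ⟨a, haX, ?_, hae⟩
    rintro ⟨-, b, hb, hba⟩
    exact hmin b ⟨hb, _root_.trans hba hae⟩ hba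
  -- Taking the complement of the rejected elements reverses inclusions, provided the rejection is
  -- monotone, so doing it twice is monotone. Knaster–Tarski then gives a pair X, Y in which each
  -- set consists of exactly what the other does not reject.
  let F : Set E →o Set E :=
    ⟨fun X => (rej s (rej r X)ᶜ)ᶜ, fun X Y h =>
      Set.compl_subset_compl.2 (rej_mono s (Set.compl_subset_compl.2 (rej_mono r h)))⟩
  set X : Set E := F.lfp with hX
  set Y : Set E := (rej r X)ᶜ with hY
  have hXY : X = (rej s Y)ᶜ := F.map_lfp.symm
  refine ⟨X ∩ Y, ?_, ?_⟩
  · rintro a ⟨haX, haY⟩ b ⟨hbX, hbY⟩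
    refine ⟨fun h => hbY ⟨hbX, a, haX, h⟩, fun h => ?_⟩
    rw [hXY] at hbX
    exact hbX ⟨hbY, a, haY, h⟩
  · intro e he
    by_cases heX : e ∈ X
    · have : e ∈ rej r X := by
        by_contra h
        exact he ⟨heX, h⟩
      obtain ⟨a, ha, ha', hae⟩ := minimal r X e this
      exact ⟨a, ⟨ha, ha'⟩, Or.inl hae⟩
    · have : e ∈ rej s Y := by
        by_contra h
        exact heX (hXY ▸ h)
      obtain ⟨a, ha, ha', hae⟩ := minimal s Y e this
      exact ⟨a, ⟨hXY ▸ ha', ha⟩, Or.inr hae⟩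

/-! ### Walks as linking sets of edges. -/

section Linked

variable {V E : Type*} (ends : E → Sym2 V)

/-- The vertices `u` and `v` are joined by a walk all of whose edges are in `A`. -/
def Linked (A : Set E) : V → V → Prop :=
  Relation.ReflTransGen fun a b => ∃ e ∈ A, ends e = s(a, b)

variable {ends}

theorem Linked.mono {A B : Set E} (h : A ⊆ B) {u v : V} (huv : Linked ends A u v) :
    Linked ends B u v :=
  Relation.ReflTransGen.lift id (fun _ _ ⟨e, he, h'⟩ => ⟨e, h he, h'⟩) _ _ huv

theorem Linked.symm {A : Set E} {u v : V} (h : Linked ends A u v) : Linked ends A v u :=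
  have : Std.Symm fun a b => ∃ e ∈ A, ends e = s(a, b) :=
    ⟨fun _ _ ⟨e, he, h'⟩ => ⟨e, he, h'.trans Sym2.eq_swap⟩⟩
  Relation.ReflTransGen.stdSymm.symm _ _ h

theorem Linked.trans {A : Set E} {u v w : V} (h : Linked ends A u v) (h' : Linked ends A v w) :
    Linked ends A u w :=
  Relation.ReflTransGen.trans h h'

theorem Linked.nonempty {A : Set E} {u v : V} (h : Linked ends A u v) (huv : u ≠ v) :
    A.Nonempty := by
  rcases Relation.ReflTransGen.cases_head h with h | ⟨_, ⟨e, he, -⟩, -⟩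
  · exact absurd h huv
  · exact ⟨e, he⟩

/-- A linking set contains a linking set ranked by a walk: every vertex on an edge is linked
to the start by edges of at most the rank of that edge. -/
theorem Linked.exists_rank {A : Set E} {u v : V} (h : Linked ends A u v) :
    ∃ (B : Set E) (ρ : E → ℕ), B ⊆ A ∧ Set.InjOn ρ B ∧ Linked ends B u v ∧
      ∀ e ∈ B, ∀ a ∈ ends e, Linked ends {e' ∈ B | ρ e' ≤ ρ e} u a := by
  classical
  suffices ∃ (B : Set E) (ρ : E → ℕ) (N : ℕ), B ⊆ A ∧ Set.InjOn ρ B ∧ Linked ends B u v ∧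
      (∀ e ∈ B, ∀ a ∈ ends e, Linked ends {e' ∈ B | ρ e' ≤ ρ e} u a) ∧ ∀ e ∈ B, ρ e < N by
    obtain ⟨B, ρ, N, h1, h2, h3, h4, -⟩ := this
    exact ⟨B, ρ, h1, h2, h3, h4⟩
  induction h with
  | refl =>
    exact ⟨∅, 0, 0, Set.empty_subset _, Set.injOn_empty _, Relation.ReflTransGen.refl, by simp,
      by simp⟩
  | @tail b c _ hbc ih =>
    obtain ⟨B, ρ, N, hBA, hinj, hl, hr, hN⟩ := ih
    obtain ⟨e, heA, he⟩ := hbc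
    -- A repeated edge has both its ends linked already and adds nothing. A new edge gets the top
    -- rank N.
    by_cases heB : e ∈ B
    · exact ⟨B, ρ, N, hBA, hinj, (hr e heB c (by simp [he])).mono fun _ h => h.1, hr, hN⟩
    · have hne : ∀ e' ∈ B, e' ≠ e := fun e' he' h => heB (h ▸ he')
      have hlc : Linked ends (insert e B) u c :=
        (hl.mono (Set.subset_insert _ _)).trans
          (Relation.ReflTransGen.single ⟨e, Set.mem_insert _ _, he⟩)
      refine ⟨insert e B, Function.update ρ e N, N + 1, Set.insert_subset heA hBA, ?_, hlc, ?_, ?_⟩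
      · rw [Set.injOn_insert heB]
        refine ⟨fun x hx y hy hxy => ?_, ?_⟩
        · rw [Function.update_of_ne (hne x hx), Function.update_of_ne (hne y hy)] at hxy
          exact hinj hx hy hxy
        · rintro ⟨x, hx, hxe⟩
          rw [Function.update_of_ne (hne x hx), Function.update_self] at hxe
          exact (hN x hx).ne hxe
      · intro e' he' a ha
        rcases he' with rfl | he'
        · have hall : {x ∈ insert e' B | Function.update ρ e' N x ≤ Function.update ρ e' N e'} =
              insert e' B := by
            ext x
            simp only [Set.mem_ofPred_eq, and_iff_left_iff_imp, Function.update_self]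
            rintro (rfl | hx)
            · simp
            · rw [Function.update_of_ne (hne x hx)]
              exact (hN x hx).le
          rw [hall]
          rw [he, Sym2.mem_iff] at ha
          rcases ha with rfl | rfl
          · exact hl.mono (Set.subset_insert _ _)
          · exact hlc
        · refine (hr e' he' a ha).mono ?_
          rintro x ⟨hx, hxe⟩
          refine ⟨Set.mem_insert_of_mem _ hx, ?_⟩
          rwa [Function.update_of_ne (hne x hx), Function.update_of_ne (hne e' he')]
      · rintro x (rfl | hx)
        · simp
        · rw [Function.update_of_ne (hne x hx)]
          exact (hN x hx).trans (Nat.lt_succ_self _)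

/-- Two partial matchings of a finite type given by a common set of contracts extend to a
permutation. -/
theorem exists_perm_extending {ι M : Type*} [Finite ι] (a b : M → ι)
    (ha : Function.Injective a) (hb : Function.Injective b) :
    ∃ π : Equiv.Perm ι, (∀ m, π (a m) = b m) ∧ ∀ i, i ∉ Set.range a → π i ∉ Set.range b := by
  classical
  cases nonempty_fintype ι
  let e : {i // i ∈ Set.range a} ≃ {i // i ∈ Set.range b} :=
    (Equiv.ofInjective a ha).symm.trans (Equiv.ofInjective b hb)
  refine ⟨e.extendSubtype, fun m => ?_, fun i hi => e.extendSubtype_not_mem i hi⟩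
  rw [e.extendSubtype_apply_of_mem (a m) ⟨m, rfl⟩]
  have : (Equiv.ofInjective a ha).symm ⟨a m, ⟨m, rfl⟩⟩ = m :=
    Equiv.ofInjective_symm_apply ha m
  simp [e, this]

/-- The first vertex of `k` edge-disjoint walks to `x` can be joined to the first vertex of
`k` other edge-disjoint walks to `x` by `k` edge-disjoint walks. -/
theorem exists_disjoint_linked_trans [Finite E] {ι : Type*} [Finite ι] {u v x : V}
    {A B : ι → Set E}
    (hA : Pairwise (Function.onFun Disjoint A)) (hB : Pairwise (Function.onFun Disjoint B))
    (hAl : ∀ i, Linked ends (A i) u x) (hBl : ∀ i, Linked ends (B i) v x) :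
    ∃ C : ι → Set E, Pairwise (Function.onFun Disjoint C) ∧ ∀ i, Linked ends (C i) u v := by
  choose A' ρ hAA hρ hAl hAr using fun i => (hAl i).exists_rank
  choose B' σ hBB hσ hBl hBr using fun i => (hBl i).exists_rank
  have huA : ∀ {e i j}, e ∈ A' i → e ∈ A' j → i = j := fun {e i j} hi hj => by
    by_contra h
    exact Set.disjoint_left.1 (hA h) (hAA _ hi) (hAA _ hj)
  have huB : ∀ {e i j}, e ∈ B' i → e ∈ B' j → i = j := fun {e i j} hi hj => by
    by_contra h
    exact Set.disjoint_left.1 (hB h) (hBB _ hi) (hBB _ hj)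
  let T := {e : E // (∃ i, e ∈ A' i) ∧ ∃ j, e ∈ B' j}
  choose α hα using fun e : T => e.2.1
  choose β hβ using fun e : T => e.2.2
  -- `r` and `s` prefer, among shared edges of the same A-walk or B-walk, the one nearer to u or to
  -- v respectively.
  let r : T → T → Prop := fun a b => α a = α b ∧ ρ (α b) a.1 < ρ (α b) b.1
  let s : T → T → Prop := fun a b => β a = β b ∧ σ (β b) a.1 < σ (β b) b.1
  have : IsTrans T r := ⟨fun a b c h h' => ⟨h.1.trans h'.1, (h'.1 ▸ h.2).trans h'.2⟩⟩
  have : IsTrans T s := ⟨fun a b c h h' => ⟨h.1.trans h'.1, (h'.1 ▸ h.2).trans h'.2⟩⟩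
  have : Std.Irrefl r := ⟨fun a h => lt_irrefl _ h.2⟩
  have : Std.Irrefl s := ⟨fun a h => lt_irrefl _ h.2⟩
  obtain ⟨M, hM, hdom⟩ := exists_kernel r s
  -- Ranks are injective on a walk, so two of its shared edges are always comparable. Independence
  -- therefore leaves at most one edge of `M` per walk.
  have hαM : Function.Injective fun m : M => α m.1 := by
    rintro ⟨a, ha⟩ ⟨b, hb⟩ (hab : α a = α b)
    have h1 : ¬ ρ (α b) a.1 < ρ (α b) b.1 := fun h => (hM a ha b hb).1 ⟨hab, h⟩
    have h2 : ¬ ρ (α b) b.1 < ρ (α b) a.1 := fun h => (hM b hb a ha).1 ⟨hab.symm, hab ▸ h⟩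
    exact Subtype.ext (Subtype.ext (hρ (α b) (hab ▸ hα a) (hα b) (le_antisymm (not_lt.1 h2) (not_lt.1 h1))))
  have hβM : Function.Injective fun m : M => β m.1 := by
    rintro ⟨a, ha⟩ ⟨b, hb⟩ (hab : β a = β b)
    have h1 : ¬ σ (β b) a.1 < σ (β b) b.1 := fun h => (hM a ha b hb).2 ⟨hab, h⟩
    have h2 : ¬ σ (β b) b.1 < σ (β b) a.1 := fun h => (hM b hb a ha).2 ⟨hab.symm, hab ▸ h⟩
    exact Subtype.ext (Subtype.ext (hσ (β b) (hab ▸ hβ a) (hβ b) (le_antisymm (not_lt.1 h2) (not_lt.1 h1))))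
  obtain ⟨π, hπ, hπ'⟩ := exists_perm_extending _ _ hαM hβM
  -- Each walk is truncated just after its edge in `M`, or kept whole if it has none.
  let P : ι → Set E := fun i => {e ∈ A' i | ∀ m ∈ M, α m = i → ρ i e ≤ ρ i m.1}
  let Q : ι → Set E := fun j => {e ∈ B' j | ∀ m ∈ M, β m = j → σ j e ≤ σ j m.1}
  -- A shared edge outside `M` is dominated by an edge of `M` on one of its two walks, hence was cut
  -- off there. Truncated walks thus meet only in edges of `M`, where `π` pairs them.
  have key : ∀ i j e, e ∈ P i → e ∈ Q (π j) → i = j := by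
    rintro i j e ⟨hi, hPi⟩ ⟨hj, hQj⟩
    let t : T := ⟨e, ⟨i, hi⟩, ⟨π j, hj⟩⟩
    have hti : α t = i := huA (hα t) hi
    have htj : β t = π j := huB (hβ t) hj
    by_cases ht : t ∈ M
    · apply π.injective
      rw [← htj, ← hti]
      exact hπ ⟨t, ht⟩
    · obtain ⟨m, hm, ⟨h1, h2⟩ | ⟨h1, h2⟩⟩ := hdom t ht
      · rw [hti] at h1 h2
        exact absurd (hPi m hm h1) (not_le.2 h2)
      · rw [htj] at h1 h2
        exact absurd (hQj m hm h1) (not_le.2 h2)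
  refine ⟨fun i => P i ∪ Q (π i), fun i j hij => ?_, fun i => ?_⟩
  · rw [Function.onFun, Set.disjoint_left]
    rintro e (he | he) (he' | he')
    · exact hij (huA he.1 he'.1)
    · exact hij (key i j e he he')
    · exact hij (key j i e he' he).symm
    · exact hij (π.injective (huB he.1 he'.1))
  · by_cases hi : i ∈ Set.range fun m : M => α m.1
    · obtain ⟨⟨m, hm⟩, rfl⟩ := hi
      have hπm : π (α m) = β m := hπ ⟨m, hm⟩
      -- Either end of the switching edge will do: both truncated walks contain the edge and reach
      -- both of its ends.
      obtain ⟨a, ha⟩ : ∃ a, a ∈ ends m.1 := ⟨_, Sym2.out_fst_mem _⟩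
      have h1 : Linked ends (P (α m)) u a := by
        refine (hAr _ m.1 (hα m) a ha).mono ?_
        rintro e ⟨he, hle⟩
        refine ⟨he, fun m' hm' h => ?_⟩
        have : m' = m := congrArg Subtype.val (@hαM ⟨m', hm'⟩ ⟨m, hm⟩ h)
        rwa [this]
      have h2 : Linked ends (Q (β m)) v a := by
        refine (hBr _ m.1 (hβ m) a ha).mono ?_
        rintro e ⟨he, hle⟩
        refine ⟨he, fun m' hm' h => ?_⟩
        have : m' = m := congrArg Subtype.val (@hβM ⟨m', hm'⟩ ⟨m, hm⟩ h)
        rwa [this]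
      exact (h1.mono Set.subset_union_left).trans
        ((hπm ▸ h2).mono Set.subset_union_right).symm
    -- An unmatched A-walk is paired by `π` with an unmatched B-walk. Both are kept whole and join
    -- at x.
    · have h1 : Linked ends (P i) u x := by
        refine (hAl i).mono fun e he => ?_
        exact ⟨he, fun m hm h => absurd ⟨⟨m, hm⟩, h⟩ hi⟩
      have h2 : Linked ends (Q (π i)) v x := by
        refine (hBl (π i)).mono fun e he => ?_
        exact ⟨he, fun m hm h => absurd ⟨⟨m, hm⟩, h⟩ (hπ' i hi)⟩
      exact (h1.mono Set.subset_union_left).trans (h2.mono Set.subset_union_right).symm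

end Linked

/-! ### The flow as an ultrametric -/

namespace CapGraph

variable {V : Type*} {W : ℕ} {G : CapGraph V W}

theorem linked_of_walk {u v : V} (p : G.graph.Walk u v) (A : Set G.UnitEdge)
    (h : ∀ e ∈ p.edges, ∃ i, (⟨e, i⟩ : G.UnitEdge) ∈ A) : Linked Sigma.fst A u v := by
  induction p with
  | nil => exact Relation.ReflTransGen.refl
  | cons hab p ih =>
    simp only [SimpleGraph.Walk.edges_cons, List.mem_cons, forall_eq_or_imp] at h
    obtain ⟨i, hi⟩ := h.1
    exact Relation.ReflTransGen.head ⟨_, hi, rfl⟩ (ih h.2)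

theorem UnitPath.linked {u v : V} (p : G.UnitPath u v) : Linked Sigma.fst p.edges u v :=
  linked_of_walk p.path.1 _ fun e he => ⟨p.copy e he, he, rfl⟩

theorem exists_unitPath_of_linked {u v : V} {A : Set G.UnitEdge} (h : Linked Sigma.fst A u v) :
    ∃ p : G.UnitPath u v, p.edges ⊆ A := by
  classical
  have key : ∃ p : G.graph.Walk u v, ∀ e ∈ p.edges, ∃ i, (⟨e, i⟩ : G.UnitEdge) ∈ A := by
    induction h with
    | refl => exact ⟨SimpleGraph.Walk.nil, by simp⟩
    | @tail b c _ hbc ih =>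
      obtain ⟨p, hp⟩ := ih
      obtain ⟨⟨e, i⟩, hA, he⟩ := hbc
      obtain rfl : e = s(b, c) := he
      have hadj : G.graph.Adj b c :=
        (G.cap_pos_iff s(b, c)).1 (Nat.zero_lt_of_lt i.2)
      refine ⟨p.concat hadj, fun e' he' => ?_⟩
      rw [SimpleGraph.Walk.edges_concat, List.concat_eq_append, List.mem_append,
        List.mem_singleton] at he'
      rcases he' with he' | rfl
      · exact hp e' he'
      · exact ⟨i, hA⟩
  obtain ⟨p, hp⟩ := key
  choose i hi using fun (e : Sym2 V) (he : e ∈ p.toPath.1.edges) =>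
    hp e (p.edges_toPath_subset_edges he)
  refine ⟨⟨p.toPath, i⟩, ?_⟩
  rintro ⟨e, j⟩ ⟨he, h⟩
  have hij : i e he = j := h
  exact hij ▸ hi e he

/-- Replaces simple paths by arbitrary linking edge sets, which can be cut and united freely. Since
u ≠ v, linking sets are nonempty, so disjoint ones yield distinct paths. -/
theorem le_flow_iff [Finite V] {u v : V} (huv : u ≠ v) {k : ℕ} :
    k ≤ G.flow u v ↔ ∃ A : Fin k → Set G.UnitEdge,
      Pairwise (Function.onFun Disjoint A) ∧ ∀ i, Linked Sigma.fst (A i) u v := by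
  classical
  constructor
  · intro hk
    obtain ⟨P, hP, hcard⟩ := (G.isGreatest_flow u v).1
    let f : Fin k ↪ P := (Fin.castLEEmb (hk.trans hcard.ge)).trans P.equivFin.symm.toEmbedding
    refine ⟨fun i => (f i).1.edges, fun i j hij => ?_, fun i => (f i).1.linked⟩
    exact hP (f i).2 (f j).2 fun h => hij (f.injective (Subtype.ext h))
  · rintro ⟨A, hA, hl⟩
    choose p hp using fun i => exists_unitPath_of_linked (hl i)
    have hdis : ∀ i j, i ≠ j → Disjoint (p i).edges (p j).edges := fun i j hij =>
      (hA hij).mono (hp i) (hp j)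
    have hinj : Function.Injective p := by
      intro i j hij
      by_contra hne
      obtain ⟨e, he⟩ := (p i).linked.nonempty huv
      exact Set.disjoint_left.1 (hdis i j hne) he (hij ▸ he)
    refine (G.isGreatest_flow u v).2 ⟨Finset.univ.map ⟨p, hinj⟩, ?_, by simp⟩
    intro a ha b hb hab
    simp only [Finset.coe_map, Function.Embedding.coeFn_mk, Finset.coe_univ, Set.image_univ,
      Set.mem_range] at ha hb
    obtain ⟨i, rfl⟩ := ha
    obtain ⟨j, rfl⟩ := hb
    exact hdis i j fun h => hab (congrArg p h)

theorem flow_comm [Finite V] {u v : V} (huv : u ≠ v) : G.flow u v = G.flow v u := by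
  refine eq_of_forall_le_iff fun k => ?_
  rw [le_flow_iff huv, le_flow_iff huv.symm]
  exact ⟨fun ⟨A, h, hl⟩ => ⟨A, h, fun i => (hl i).symm⟩,
    fun ⟨A, h, hl⟩ => ⟨A, h, fun i => (hl i).symm⟩⟩

theorem min_flow_le_flow [Finite V] {u v x : V} (hux : u ≠ x) (hxv : x ≠ v) (huv : u ≠ v) :
    min (G.flow u x) (G.flow x v) ≤ G.flow u v := by
  obtain ⟨A, hA, hAl⟩ := (le_flow_iff hux).1 (min_le_left (G.flow u x) (G.flow x v))
  obtain ⟨B, hB, hBl⟩ := (le_flow_iff hxv).1 (min_le_right (G.flow u x) (G.flow x v))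
  cases nonempty_fintype V
  classical
  exact (le_flow_iff huv).2
    (exists_disjoint_linked_trans hA hB hAl fun i => (hBl i).symm)

theorem one_le_flow [Finite V] {u v : V} (huv : u ≠ v) : 1 ≤ G.flow u v := by
  obtain ⟨p⟩ := G.connected.preconnected u v
  refine (le_flow_iff huv).2 ⟨fun _ => Set.univ, fun i j hij => absurd (Subsingleton.elim i j) hij,
    fun _ => linked_of_walk p _ fun e he => ⟨⟨0, ?_⟩, trivial⟩⟩
  exact (G.cap_pos_iff e).2 (p.edges_subset_edgeSet he)

/-- One edge chosen from each disjoint linking set is determined by an ordered pair of ends and a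
copy number below W. The bound is crude, but only its logarithm matters. -/
theorem flow_le [Fintype V] {u v : V} (huv : u ≠ v) :
    G.flow u v ≤ Fintype.card V ^ 2 * W := by
  classical
  obtain ⟨A, hA, hl⟩ := (le_flow_iff huv).1 (le_refl (G.flow u v))
  choose e he using fun i => (hl i).nonempty huv
  have hinj : Function.Injective fun i => ((e i).1.out, Fin.castLE (G.cap_le _) (e i).2) := by
    intro i j hij
    by_contra hne
    refine Set.disjoint_left.1 (hA hne) (he i) ?_
    have : e i = e j := by
      have h1 := congrArg Prod.fst hij
      have h2 := congrArg (Fin.val ∘ Prod.snd) hij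
      simp only [Function.comp, Fin.val_castLE] at h1 h2
      have h1' : (e i).1 = (e j).1 := by
        rw [← Quot.out_eq (e i).1, ← Quot.out_eq (e j).1, h1]
      generalize e i = a at h1' h2
      generalize e j = b at h1' h2
      obtain ⟨a, k⟩ := a
      obtain ⟨b, l⟩ := b
      obtain rfl : a = b := h1'
      exact congrArg (Sigma.mk a) (Fin.ext h2)
    exact this ▸ he j
  have := Fintype.card_le_of_injective _ hinj
  simpa [sq] using this

end CapGraph

/-! ### Addresses

An address is a string over the letters `L = 00`, `M = 01`, `R = 1`, in which `M` ends the name of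
a position on a heavy path. -/

/-- The initial part of a string of letters up to the first letter `M`. The flag tells whether
the first bit of the current letter has been read already. -/
def finish : Bool → List Bool → List Bool
  | _, [] => []
  | mid, c :: l => c :: if mid && c then [] else finish (!mid && !c) l

/-- The address of the meeting node of two addresses: their common prefix, completed by the
smaller one up to the next letter `M`. -/
def meet : Bool → List Bool → List Bool → List Bool
  | mid, [], b => finish mid b
  | mid, x :: a, [] => finish mid (x :: a)
  | mid, x :: a, y :: b =>
    if x = y then x :: meet (!mid && !x) a b
    else if x = false then finish mid (x :: a) else finish mid (y :: b)

theorem meet_nil (mid : Bool) (a : List Bool) : meet mid a [] = finish mid a := by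
  cases a <;> simp [meet, finish]

theorem meet_comm (mid : Bool) (a b : List Bool) : meet mid a b = meet mid b a := by
  induction a generalizing mid b with
  | nil => rw [meet_nil, meet]
  | cons x a ih =>
    cases b with
    | nil => simp [meet]
    | cons y b =>
      by_cases h : x = y
      · subst h
        simp [meet, ih]
      · cases x <;> cases y <;> simp_all [meet]

/-! ### Heavy paths of an ultrametric -/

section Ultrametric

variable {V : Type*}

/-- Similarity in the sense of an ultrametric: symmetric, with the strong triangle inequality for
distinct points. -/
structure IsSimilarity (f : V → V → ℕ) : Prop where
  symm : ∀ u v, u ≠ v → f u v = f v u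
  min_le : ∀ u x v, u ≠ x → x ≠ v → u ≠ v → min (f u x) (f x v) ≤ f u v

variable {f : V → V → ℕ}

/-- Addresses of at most `b` bits for the vertices on a segment of a heavy path that ends at `x`;
`val` is the value stored at a vertex. -/
structure SegmentAddressing (f : V → V → ℕ) (x : V) (D : Finset V) (b : ℕ)
    (addr : V → List Bool) (val : V → ℕ) : Prop where
  ne_nil : ∀ u ∈ D, addr u ≠ []
  length_le : ∀ u ∈ D, (addr u).length ≤ b
  injOn : Set.InjOn addr D
  finish : ∀ u ∈ D, ∃ w ∈ D, addr w = finish false (addr u) ∧ val w = f u x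
  meet : ∀ u ∈ D, ∀ v ∈ D, u ≠ v → ∃ w ∈ D, addr w = meet false (addr u) (addr v) ∧ val w = f u v

/-- Addresses of at most `b` bits for the vertices of `S`, whose heavy path ends at `x`. -/
structure Addressing (f : V → V → ℕ) (x : V) (S : Finset V) (b : ℕ)
    (addr : V → List Bool) (val : V → ℕ) : Prop where
  mem : x ∈ S
  nil : addr x = []
  length_le : ∀ u ∈ S, (addr u).length ≤ b
  injOn : Set.InjOn addr S
  meet : ∀ u ∈ S, ∀ v ∈ S, u ≠ v →
    ∃ w ∈ S, w ≠ x ∧ addr w = meet false (addr u) (addr v) ∧ val w = f u v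

theorem Addressing.mono {x : V} {S : Finset V} {b b' : ℕ} {addr : V → List Bool} {val : V → ℕ}
    (h : Addressing f x S b addr val) (hb : b ≤ b') : Addressing f x S b' addr val :=
  ⟨h.mem, h.nil, fun u hu => (h.length_le u hu).trans hb, h.injOn, h.meet⟩

/-- A chain has a part with at most half of the weight on either side. -/
theorem exists_median (c : List (Finset V)) (t : ℕ) (ht : 0 < t)
    (h : t ≤ (c.map Finset.card).sum) :
    ∃ l p r, c = l ++ p :: r ∧ (l.map Finset.card).sum < t ∧
      t ≤ (l.map Finset.card).sum + p.card := by
  induction c generalizing t with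
  | nil => simp at h; omega
  | cons A c ih =>
    by_cases hA : t ≤ A.card
    · exact ⟨[], A, c, rfl, by simpa, by simpa⟩
    · simp only [List.map_cons, List.sum_cons] at h
      obtain ⟨l, p, r, rfl, h1, h2⟩ := ih (t - A.card) (by omega) (by omega)
      refine ⟨A :: l, p, r, rfl, ?_, ?_⟩ <;> simp only [List.map_cons, List.sum_cons] <;> omega

/-! ### Splits, heavy paths and balanced addresses. -/

variable [DecidableEq V]

/-- A set with two points splits into two parts across which the similarity is constant. -/
theorem IsSimilarity.exists_split (hf : IsSimilarity f) {S : Finset V} (hS : 1 < S.card) :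
    ∃ (A B : Finset V) (k : ℕ), A.Nonempty ∧ B.Nonempty ∧ Disjoint A B ∧ A ∪ B = S ∧
      2 * A.card ≤ S.card ∧ ∀ a ∈ A, ∀ b ∈ B, f a b = k := by
  obtain ⟨a₀, ha₀, b₀, hb₀, hab₀⟩ := Finset.one_lt_card.1 hS
  obtain ⟨⟨u, v⟩, huv, hmin⟩ := S.offDiag.exists_min_image (fun p => f p.1 p.2)
    ⟨(a₀, b₀), Finset.mem_offDiag.2 ⟨ha₀, hb₀, hab₀⟩⟩
  obtain ⟨hu, hv, hne⟩ := Finset.mem_offDiag.1 huv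
  simp only [Finset.mem_offDiag, Prod.forall, and_imp] at hmin
  -- With f u v minimal on S, `A` is the class of vertices more similar to u than that. For b
  -- outside, f u b is minimal, and the strong triangle inequality forces f a b to be minimal too.
  let A := S.filter fun a => a = u ∨ f u v < f u a
  let B := S.filter fun a => ¬ (a = u ∨ f u v < f u a)
  have hAB : Disjoint A B := Finset.disjoint_filter_filter_not S S _
  have hU : A ∪ B = S := Finset.filter_union_filter_not_eq _ S
  have hA : A.Nonempty := ⟨u, Finset.mem_filter.2 ⟨hu, Or.inl rfl⟩⟩
  have hB : B.Nonempty := ⟨v, Finset.mem_filter.2 ⟨hv, by simp [hne.symm]⟩⟩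
  have hk : ∀ a ∈ A, ∀ b ∈ B, f a b = f u v := by
    intro a ha b hb
    have hab : a ≠ b := fun h => Finset.disjoint_left.1 hAB ha (h ▸ hb)
    obtain ⟨haS, ha⟩ := Finset.mem_filter.1 ha
    obtain ⟨hbS, hb⟩ := Finset.mem_filter.1 hb
    push Not at hb
    have h1 := hmin a b haS hbS hab
    by_cases hau : a = u
    · subst hau
      exact le_antisymm hb.2 h1
    · have h2 := hf.min_le u a b (Ne.symm hau) hab (Ne.symm hb.1)
      have h3 := ha.resolve_left hau
      rcases min_le_iff.1 h2 with h | h <;> omega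
  have hcard : A.card + B.card = S.card := by
    rw [← Finset.card_union_of_disjoint hAB, hU]
  rcases le_total A.card B.card with h | h
  · exact ⟨A, B, f u v, hA, hB, hAB, hU, by omega, hk⟩
  · refine ⟨B, A, f u v, hB, hA, hAB.symm, by rw [Finset.union_comm, hU], by omega, ?_⟩
    intro b hb a ha
    rw [← hk a ha b hb]
    exact hf.symm b a fun h => Finset.disjoint_left.1 hAB ha (h ▸ hb)

/-- The union of the sets in a list. -/
def unionList (c : List (Finset V)) : Finset V := c.foldr (· ∪ ·) ∅

@[simp] theorem unionList_nil : unionList ([] : List (Finset V)) = ∅ := rfl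

@[simp] theorem unionList_cons (A : Finset V) (c : List (Finset V)) :
    unionList (A :: c) = A ∪ unionList c := rfl

@[simp] theorem unionList_append (c d : List (Finset V)) :
    unionList (c ++ d) = unionList c ∪ unionList d := by
  induction c with
  | nil => simp
  | cons A c ih => simp [ih, Finset.union_assoc]

theorem mem_unionList {c : List (Finset V)} {v : V} : v ∈ unionList c ↔ ∃ A ∈ c, v ∈ A := by
  induction c with
  | nil => simp
  | cons A c ih => simp [ih]

/-- The light parts hanging off a segment of a heavy path that ends at `x`. -/
structure IsChain (f : V → V → ℕ) (x : V) (c : List (Finset V)) : Prop where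
  nonempty : ∀ A ∈ c, A.Nonempty
  notMem : x ∉ unionList c
  pairwise : c.Pairwise fun A B => Disjoint A B ∧ ∀ a ∈ A, ∀ b ∈ B, f a b = f a x
  const : ∀ A ∈ c, ∀ a ∈ A, ∀ a' ∈ A, f a x = f a' x

/-- Heavy path decomposition. -/
theorem IsSimilarity.exists_chain (hf : IsSimilarity f) (S : Finset V) (hS : S.Nonempty) :
    ∃ (x : V) (c : List (Finset V)), IsChain f x c ∧ insert x (unionList c) = S ∧
      ∀ A ∈ c, 2 * A.card ≤ S.card := by
  induction S using Finset.strongInduction with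
  | H S ih =>
    rcases Nat.lt_or_ge 1 S.card with h | h
    · obtain ⟨A, B, k, hA, hB, hAB, rfl, hcard, hk⟩ := hf.exists_split h
      have hBS : B ⊂ A ∪ B := by
        refine Finset.ssubset_iff_subset_ne.2 ⟨Finset.subset_union_right, fun h => ?_⟩
        obtain ⟨a, ha⟩ := hA
        exact Finset.disjoint_left.1 hAB ha (h ▸ Finset.mem_union_left _ ha)
      obtain ⟨x, c, hc, hx, hcc⟩ := ih B hBS hB
      have hxB : x ∈ B := hx ▸ Finset.mem_insert_self _ _
      have hcB : unionList c ⊆ B := hx ▸ Finset.subset_insert _ _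
      refine ⟨x, A :: c, ⟨?_, ?_, ?_, ?_⟩, ?_, ?_⟩
      · exact List.forall_mem_cons.2 ⟨hA, hc.nonempty⟩
      · rw [unionList_cons, Finset.mem_union, not_or]
        exact ⟨fun h => Finset.disjoint_left.1 hAB h hxB, hc.notMem⟩
      · refine List.pairwise_cons.2 ⟨fun D hD => ?_, hc.pairwise⟩
        have hDB : D ⊆ B := fun v hv => hcB (mem_unionList.2 ⟨D, hD, hv⟩)
        exact ⟨hAB.mono_right hDB, fun a ha b hb => by rw [hk a ha b (hDB hb), hk a ha x hxB]⟩
      · refine List.forall_mem_cons.2 ⟨fun a ha a' ha' => ?_, hc.const⟩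
        rw [hk a ha x hxB, hk a' ha' x hxB]
      · rw [unionList_cons, ← Finset.union_insert, hx]
      · refine List.forall_mem_cons.2 ⟨hcard, fun D hD => (hcc D hD).trans ?_⟩
        exact Finset.card_le_card hBS.1
    · obtain ⟨x, rfl⟩ := Finset.card_eq_one.1 (le_antisymm h hS.card_pos)
      exact ⟨x, [], ⟨by simp, by simp, by simp, by simp⟩, by simp, by simp⟩

theorem card_unionList {c : List (Finset V)} (hc : c.Pairwise Disjoint) :
    (unionList c).card = (c.map Finset.card).sum := by
  induction c with
  | nil => simp
  | cons A c ih =>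
    obtain ⟨h1, h2⟩ := List.pairwise_cons.1 hc
    rw [unionList_cons, Finset.card_union_of_disjoint, ih h2, List.map_cons, List.sum_cons]
    refine Finset.disjoint_left.2 fun v hv hv' => ?_
    obtain ⟨B, hB, hvB⟩ := mem_unionList.1 hv'
    exact Finset.disjoint_left.1 (h1 B hB) hv hvB

/-- The end x takes the empty address, which counts as lying after every position of the path. A
meeting with x then reduces to `finish`. -/
theorem SegmentAddressing.addressing {x : V} {D : Finset V} {b : ℕ} {addr : V → List Bool}
    {val : V → ℕ} (hf : IsSimilarity f) (h : SegmentAddressing f x D b addr val) (hx : x ∉ D) :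
    Addressing f x (insert x D) b (Function.update addr x []) val := by
  have hne : ∀ u ∈ D, u ≠ x := fun u hu h => hx (h ▸ hu)
  have hup : ∀ u ∈ D, Function.update addr x [] u = addr u := fun u hu =>
    Function.update_of_ne (hne u hu) _ _
  refine ⟨Finset.mem_insert_self _ _, by simp, ?_, ?_, ?_⟩
  · intro u hu
    rcases Finset.mem_insert.1 hu with rfl | hu
    · simp
    · rw [hup u hu]
      exact h.length_le u hu
  · rw [Finset.coe_insert, Set.injOn_insert (by simpa using hx)]
    refine ⟨fun u hu v hv huv => ?_, ?_⟩
    · rw [hup u hu, hup v hv] at huv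
      exact h.injOn hu hv huv
    · rintro ⟨u, hu, huv⟩
      rw [hup u hu, Function.update_self] at huv
      exact h.ne_nil u hu huv
  · have key : ∀ u ∈ D, ∃ w ∈ insert x D, w ≠ x ∧ Function.update addr x [] w =
        FlowLabeling.meet false (Function.update addr x [] u) (Function.update addr x [] x) ∧
        val w = f u x := by
      intro u hu
      obtain ⟨w, hw, h1, h2⟩ := h.finish u hu
      refine ⟨w, Finset.mem_insert_of_mem hw, hne w hw, ?_, h2⟩
      rw [hup w hw, hup u hu, Function.update_self, meet_nil, h1]
    intro u hu v hv huv
    rcases Finset.mem_insert.1 hu with rfl | huD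
    · rcases Finset.mem_insert.1 hv with rfl | hvD
      · exact absurd rfl huv
      · rw [hf.symm _ _ huv, meet_comm]
        exact key v hvD
    · rcases Finset.mem_insert.1 hv with rfl | hvD
      · exact key u huD
      · obtain ⟨w, hw, h1, h2⟩ := h.meet u huD v hvD huv
        exact ⟨w, Finset.mem_insert_of_mem hw, hne w hw,
          by rw [hup w hw, hup u huD, hup v hvD, h1], h2⟩

/-- Addressings of two segments of a heavy path and of the light part between them combine. -/
theorem SegmentAddressing.glue {x y : V} {D₁ S D₂ : Finset V} {b : ℕ}
    {addr₁ addr addr₂ : V → List Bool} {val₁ val val₂ : V → ℕ} (hf : IsSimilarity f)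
    (h₁ : SegmentAddressing f x D₁ b addr₁ val₁) (h : Addressing f y S b addr val)
    (h₂ : SegmentAddressing f x D₂ b addr₂ val₂)
    (d₁ : Disjoint D₁ S) (d₂ : Disjoint D₁ D₂) (d₃ : Disjoint S D₂)
    (hS : ∀ u ∈ S, ∀ v ∈ S, f u x = f v x)
    (c₁ : ∀ u ∈ D₁, ∀ v ∈ S ∪ D₂, f u v = f u x) (c₂ : ∀ u ∈ S, ∀ v ∈ D₂, f u v = f u x) :
    ∃ addr' val', SegmentAddressing f x (D₁ ∪ S ∪ D₂) (b + 2) addr' val' := by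
  -- Prefix L for the earlier segment, M for the light part itself, R for the later segment. The
  -- smaller prefix belongs to the vertex that decides the flow.
  let addr' : V → List Bool := fun u =>
    if u ∈ D₁ then false :: false :: addr₁ u else
      if u ∈ S then false :: true :: addr u else true :: addr₂ u
  -- Within S the meeting vertex is never y, so y is free to hold the value of the position S. Its
  -- address is exactly the name of that position, ending in M.
  let val' : V → ℕ := fun u =>
    if u ∈ D₁ then val₁ u else if u ∈ S then if u = y then f y x else val u else val₂ u
  have a₁ : ∀ u ∈ D₁, addr' u = false :: false :: addr₁ u := fun u hu => if_pos hu
  have v₁ : ∀ u ∈ D₁, val' u = val₁ u := fun u hu => if_pos hu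
  have nS : ∀ u ∈ S, u ∉ D₁ := fun u hu hu' => Finset.disjoint_left.1 d₁ hu' hu
  have n₂ : ∀ u ∈ D₂, u ∉ D₁ := fun u hu hu' => Finset.disjoint_left.1 d₂ hu' hu
  have n₂' : ∀ u ∈ D₂, u ∉ S := fun u hu hu' => Finset.disjoint_left.1 d₃ hu' hu
  have aS : ∀ u ∈ S, addr' u = false :: true :: addr u := fun u hu => by
    simp only [addr', if_neg (nS u hu), if_pos hu]
  have vS : ∀ u ∈ S, u ≠ y → val' u = val u := fun u hu hy => by
    simp only [val', if_neg (nS u hu), if_pos hu, if_neg hy]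
  have vy : val' y = f y x := by
    simp only [val', if_neg (nS y h.mem), if_pos h.mem, if_true]
  have a₂ : ∀ u ∈ D₂, addr' u = true :: addr₂ u := fun u hu => by
    simp only [addr', if_neg (n₂ u hu), if_neg (n₂' u hu)]
  have v₂ : ∀ u ∈ D₂, val' u = val₂ u := fun u hu => by
    simp only [val', if_neg (n₂ u hu), if_neg (n₂' u hu)]
  have i₁ : D₁ ⊆ D₁ ∪ S ∪ D₂ := Finset.subset_union_left.trans Finset.subset_union_left
  have iS : S ⊆ D₁ ∪ S ∪ D₂ := Finset.subset_union_right.trans Finset.subset_union_left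
  have i₂ : D₂ ⊆ D₁ ∪ S ∪ D₂ := Finset.subset_union_right
  have cases : ∀ {P : V → Prop}, (∀ u ∈ D₁, P u) → (∀ u ∈ S, P u) → (∀ u ∈ D₂, P u) →
      ∀ u ∈ D₁ ∪ S ∪ D₂, P u := by
    intro P p q r u hu
    rcases Finset.mem_union.1 hu with hu | hu
    · exact (Finset.mem_union.1 hu).elim (p u) (q u)
    · exact r u hu
  have f₁ : ∀ u ∈ D₁, ∃ w ∈ D₁ ∪ S ∪ D₂,
      addr' w = FlowLabeling.finish false (addr' u) ∧ val' w = f u x := by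
    intro u hu
    obtain ⟨w, hw, hw1, hw2⟩ := h₁.finish u hu
    exact ⟨w, i₁ hw, by simp [a₁ w hw, a₁ u hu, hw1, FlowLabeling.finish], by rw [v₁ w hw, hw2]⟩
  have fS : ∀ u ∈ S, ∃ w ∈ D₁ ∪ S ∪ D₂,
      addr' w = FlowLabeling.finish false (addr' u) ∧ val' w = f u x := by
    intro u hu
    exact ⟨y, iS h.mem, by simp [aS y h.mem, aS u hu, h.nil, FlowLabeling.finish],
      by rw [vy, hS y h.mem u hu]⟩
  refine ⟨addr', val', ?_, ?_, ?_, ?_, ?_⟩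
  · refine cases (fun u hu => ?_) (fun u hu => ?_) (fun u hu => ?_)
    · simp [a₁ u hu]
    · simp [aS u hu]
    · simp [a₂ u hu]
  · refine cases (fun u hu => ?_) (fun u hu => ?_) (fun u hu => ?_)
    · simpa [a₁ u hu] using h₁.length_le u hu
    · simpa [aS u hu] using h.length_le u hu
    · have := h₂.length_le u hu
      simp only [a₂ u hu, List.length_cons]
      omega
  · intro u hu v hv
    revert v hv
    revert u hu
    refine cases (fun u hu => ?_) (fun u hu => ?_) (fun u hu => ?_) <;>
    refine cases (fun v hv => ?_) (fun v hv => ?_) (fun v hv => ?_) <;>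
    simp only [a₁, aS, a₂, hu, hv, List.cons.injEq, true_and, false_and, reduceCtorEq,
      false_imp_iff]
    · exact fun huv => h₁.injOn hu hv huv
    · exact fun huv => h.injOn hu hv huv
    · exact fun huv => h₂.injOn hu hv huv
  · refine cases f₁ fS fun u hu => ?_
    obtain ⟨w, hw, hw1, hw2⟩ := h₂.finish u hu
    exact ⟨w, i₂ hw, by simp [a₂ w hw, a₂ u hu, hw1, FlowLabeling.finish], by rw [v₂ w hw, hw2]⟩
  · have m₁ : ∀ u ∈ D₁, ∀ v ∈ S ∪ D₂, ∃ w ∈ D₁ ∪ S ∪ D₂,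
        addr' w = FlowLabeling.meet false (addr' u) (addr' v) ∧ val' w = f u v := by
      intro u hu v hv
      have : FlowLabeling.meet false (addr' u) (addr' v) = FlowLabeling.finish false (addr' u) := by
        rcases Finset.mem_union.1 hv with hv' | hv'
        · simp [a₁ u hu, aS v hv', FlowLabeling.meet, FlowLabeling.finish]
        · simp [a₁ u hu, a₂ v hv', FlowLabeling.meet, FlowLabeling.finish]
      rw [this, c₁ u hu v hv]
      exact f₁ u hu
    have m₂ : ∀ u ∈ S, ∀ v ∈ D₂, ∃ w ∈ D₁ ∪ S ∪ D₂,
        addr' w = FlowLabeling.meet false (addr' u) (addr' v) ∧ val' w = f u v := by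
      intro u hu v hv
      have : FlowLabeling.meet false (addr' u) (addr' v) = FlowLabeling.finish false (addr' u) := by
        simp [aS u hu, a₂ v hv, FlowLabeling.meet, FlowLabeling.finish]
      rw [this, c₂ u hu v hv]
      exact fS u hu
    refine cases (fun u hu => ?_) (fun u hu => ?_) (fun u hu => ?_) <;>
    refine cases (fun v hv => ?_) (fun v hv => ?_) (fun v hv => ?_) <;> intro huv
    · obtain ⟨w, hw, hw1, hw2⟩ := h₁.meet u hu v hv huv
      exact ⟨w, i₁ hw, by simp [a₁ w hw, a₁ u hu, a₁ v hv, hw1, FlowLabeling.meet],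
        by rw [v₁ w hw, hw2]⟩
    · exact m₁ u hu v (Finset.mem_union_left _ hv)
    · exact m₁ u hu v (Finset.mem_union_right _ hv)
    · rw [meet_comm, hf.symm u v huv]
      exact m₁ v hv u (Finset.mem_union_left _ hu)
    · obtain ⟨w, hw, hwy, hw1, hw2⟩ := h.meet u hu v hv huv
      exact ⟨w, iS hw, by simp [aS w hw, aS u hu, aS v hv, hw1, FlowLabeling.meet],
        by rw [vS w hw hwy, hw2]⟩
    · exact m₂ u hu v hv
    · rw [meet_comm, hf.symm u v huv]
      exact m₁ v hv u (Finset.mem_union_right _ hu)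
    · rw [meet_comm, hf.symm u v huv]
      exact m₂ v hv u hu
    · obtain ⟨w, hw, hw1, hw2⟩ := h₂.meet u hu v hv huv
      exact ⟨w, i₂ hw, by simp [a₂ w hw, a₂ u hu, a₂ v hv, hw1, FlowLabeling.meet],
        by rw [v₂ w hw, hw2]⟩

/-- If every light part has short addresses, then so does a segment of a heavy path. -/
theorem IsChain.exists_segmentAddressing (hf : IsSimilarity f) {x : V} {c : List (Finset V)}
    (hc : IsChain f x c)
    (ih : ∀ A ∈ c, ∃ y addr val, Addressing f y A (4 * Nat.log 2 A.card) addr val) {b : ℕ}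
    (hb : 4 * Nat.log 2 (unionList c).card ≤ b) (hb' : ∀ A ∈ c, 4 * Nat.log 2 A.card + 2 ≤ b) :
    ∃ addr val, SegmentAddressing f x (unionList c) b addr val := by
  induction hn : c.length using Nat.strong_induction_on generalizing c b with
  | _ n ihn =>
    subst hn
    by_cases hnil : c = []
    · subst hnil
      exact ⟨fun _ => [], fun _ => 0, by simp, by simp, by simp, by simp, by simp⟩
    have hdis := card_unionList (hc.pairwise.imp fun h => h.1)
    have hpos : 0 < (unionList c).card := by
      obtain ⟨A, hA⟩ := List.exists_mem_of_ne_nil c hnil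
      obtain ⟨a, ha⟩ := hc.nonempty A hA
      exact Finset.card_pos.2 ⟨a, mem_unionList.2 ⟨A, hA, ha⟩⟩
    -- With threshold ⌈N/2⌉, the parts before p and those after p each weigh at most N/2.
    obtain ⟨l, p, r, rfl, h1, h2⟩ := exists_median c (((unionList c).card + 1) / 2) (by omega)
      (by omega)
    have hpw := List.pairwise_append.1 hc.pairwise
    have hpr := List.pairwise_cons.1 hpw.2.1
    have hb2 : 2 ≤ b := le_trans (by omega) (hb' p (by simp))
    -- This is where the factor 4 comes from: halving the weight frees four bits, two for the letter
    -- chosen here and two reserved for the letter M that later enters a light part.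
    have hlogb : ∀ {d : List (Finset V)}, (∀ A ∈ d, A ∈ l ++ p :: r) → d.Pairwise Disjoint →
        2 * (d.map Finset.card).sum ≤ (unionList (l ++ p :: r)).card →
        4 * Nat.log 2 (unionList d).card ≤ b - 2 ∧
          ∀ A ∈ d, 4 * Nat.log 2 A.card + 2 ≤ b - 2 := by
      intro d hd hdd hsum
      rw [← card_unionList hdd] at hsum
      have hlog : (unionList d).card ≠ 0 →
          Nat.log 2 (unionList d).card + 1 ≤ Nat.log 2 (unionList (l ++ p :: r)).card := by
        intro h0
        rw [← Nat.log_mul_base one_lt_two h0]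
        exact Nat.log_mono_right (by omega)
      constructor
      · by_cases h0 : (unionList d).card = 0
        · simp [h0]
        · have := hlog h0
          omega
      · intro A hA
        have hAd : A.card ≤ (unionList d).card :=
          Finset.card_le_card fun v hv => mem_unionList.2 ⟨A, hA, hv⟩
        have hA0 : 0 < A.card := Finset.card_pos.2 (hc.nonempty A (hd A hA))
        have := hlog (by omega)
        have := Nat.log_mono_right (b := 2) hAd
        omega
    have sub : ∀ {d : List (Finset V)}, (∀ A ∈ d, A ∈ l ++ p :: r) → d.Sublist (l ++ p :: r) →
        IsChain f x d := fun {d} hd hs => ⟨fun A hA => hc.nonempty A (hd A hA),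
      fun h => hc.notMem (by
        obtain ⟨A, hA, hxA⟩ := mem_unionList.1 h
        exact mem_unionList.2 ⟨A, hd A hA, hxA⟩), hc.pairwise.sublist hs,
      fun A hA => hc.const A (hd A hA)⟩
    have hl : ∀ A ∈ l, A ∈ l ++ p :: r := fun A hA => by simp [hA]
    have hr : ∀ A ∈ r, A ∈ l ++ p :: r := fun A hA => by simp [hA]
    simp only [List.map_append, List.map_cons, List.sum_append, List.sum_cons] at hdis
    obtain ⟨bl, bl'⟩ := hlogb hl (hpw.1.imp fun h => h.1) (by omega)
    obtain ⟨br, br'⟩ := hlogb hr (hpr.2.imp fun h => h.1) (by omega)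
    obtain ⟨addr₁, val₁, s₁⟩ := ihn l.length (by simp)
      (sub hl (List.sublist_append_left _ _)) (fun A hA => ih A (hl A hA)) bl bl' rfl
    obtain ⟨addr₂, val₂, s₂⟩ := ihn r.length (by simp; omega)
      (sub hr ((List.sublist_cons_self _ _).trans (List.sublist_append_right _ _)))
      (fun A hA => ih A (hr A hA)) br br' rfl
    obtain ⟨y, addr, val, s⟩ := ih p (by simp)
    have hbp := hb' p (by simp)
    have hlp : ∀ A ∈ l, ∀ B ∈ p :: r, Disjoint A B ∧ ∀ a ∈ A, ∀ b ∈ B, f a b = f a x := hpw.2.2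
    obtain ⟨addr', val', h'⟩ := s₁.glue hf (s.mono (b' := b - 2) (by omega)) s₂
      (Finset.disjoint_left.2 fun v hv hv' => by
        obtain ⟨A, hA, hvA⟩ := mem_unionList.1 hv
        exact Finset.disjoint_left.1 (hlp A hA p (by simp)).1 hvA hv')
      (Finset.disjoint_left.2 fun v hv hv' => by
        obtain ⟨A, hA, hvA⟩ := mem_unionList.1 hv
        obtain ⟨B, hB, hvB⟩ := mem_unionList.1 hv'
        exact Finset.disjoint_left.1 (hlp A hA B (by simp [hB])).1 hvA hvB)
      (Finset.disjoint_left.2 fun v hv hv' => by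
        obtain ⟨B, hB, hvB⟩ := mem_unionList.1 hv'
        exact Finset.disjoint_left.1 (hpr.1 B hB).1 hv hvB)
      (hc.const p (by simp))
      (fun u hu v hv => by
        obtain ⟨A, hA, huA⟩ := mem_unionList.1 hu
        obtain ⟨B, hB, hvB⟩ := mem_unionList (c := p :: r) |>.1 hv
        exact (hlp A hA B hB).2 u huA v hvB)
      (fun u hu v hv => by
        obtain ⟨B, hB, hvB⟩ := mem_unionList.1 hv
        exact (hpr.1 B hB).2 u hu v hvB)
    refine ⟨addr', val', ?_⟩
    rw [unionList_append, unionList_cons, ← Finset.union_assoc]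
    rwa [Nat.sub_add_cancel hb2] at h'

/-- Every nonempty set of vertices has addresses of logarithmic length. -/
theorem IsSimilarity.exists_addressing (hf : IsSimilarity f) (S : Finset V) (hS : S.Nonempty) :
    ∃ x addr val, Addressing f x S (4 * Nat.log 2 S.card) addr val := by
  induction S using Finset.strongInduction with
  | H S ih =>
    obtain ⟨x, c, hc, rfl, hcard⟩ := hf.exists_chain S hS
    have hlog : ∀ A ∈ c,
        Nat.log 2 A.card + 1 ≤ Nat.log 2 (insert x (unionList c)).card := by
      intro A hA
      rw [← Nat.log_mul_base one_lt_two (Finset.card_pos.2 (hc.nonempty A hA)).ne']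
      exact Nat.log_mono_right (by have := hcard A hA; omega)
    obtain ⟨addr, val, h⟩ := hc.exists_segmentAddressing hf
      (fun A hA => ih A (by
        have hsub : A ⊆ unionList c := fun v hv => mem_unionList.2 ⟨A, hA, hv⟩
        exact Finset.ssubset_of_subset_of_ssubset hsub (Finset.ssubset_insert hc.notMem))
        (hc.nonempty A hA))
      -- A light part has at most half the size, so its own addresses leave four spare bits, more
      -- than the two required.
      (b := 4 * Nat.log 2 (insert x (unionList c)).card)
      (Nat.mul_le_mul_left _ (Nat.log_mono_right (Finset.card_le_card (Finset.subset_insert _ _))))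
      (fun A hA => by have := hlog A hA; omega)
    exact ⟨x, _, val, h.addressing hf hc.notMem⟩

end Ultrametric

/-! ### Positive numbers as bit strings -/

/-- The positive number with the given binary digits, least significant digit first, below an
implicit leading digit `1`. -/
def binaryValue : List Bool → ℕ
  | [] => 1
  | b :: l => Nat.bit b (binaryValue l)

/-- The implicit leading digit comes last in the encoding, so the decoder only has to place one
`true` beneath the copied data. -/
theorem encodeNat_binaryValue (l : List Bool) :
    Computability.encodeNat (binaryValue l) = l ++ [true] := by
  suffices ∃ p, (binaryValue l : Num) = Num.pos p ∧ Computability.encodePosNum p = l ++ [true] by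
    obtain ⟨p, hp, h⟩ := this
    rw [Computability.encodeNat, hp]
    exact h
  induction l with
  | nil => exact ⟨1, rfl, rfl⟩
  | cons b l ih =>
    obtain ⟨p, hp, h⟩ := ih
    rw [binaryValue, ← Num.ofNat'_eq, Num.ofNat'_bit, Num.ofNat'_eq, hp]
    cases b
    · exact ⟨p.bit0, rfl, by rw [Computability.encodePosNum, h]; rfl⟩
    · exact ⟨p.bit1, rfl, by rw [Computability.encodePosNum, h]; rfl⟩

theorem binaryValue_injective : Function.Injective binaryValue := fun l l' h => by
  have := congrArg Computability.encodeNat h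
  rwa [encodeNat_binaryValue, encodeNat_binaryValue, List.append_left_inj] at this

theorem binaryValue_lt (l : List Bool) : binaryValue l < 2 ^ (l.length + 1) := by
  induction l with
  | nil => simp [binaryValue]
  | cons b l ih =>
    rw [binaryValue, Nat.bit_val, List.length_cons, pow_succ]
    have := b.toNat_le
    omega

theorem exists_binaryValue_eq (n : ℕ) (hn : 0 < n) :
    ∃ l, binaryValue l = n ∧ l.length ≤ Nat.log 2 n := by
  induction n using Nat.strong_induction_on with
  | _ n ih =>
    rcases Nat.lt_or_ge n 2 with h | h
    · exact ⟨[], by rw [binaryValue]; omega, by simp⟩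
    · obtain ⟨l, hl, hlen⟩ := ih (n / 2) (by omega) (by omega)
      refine ⟨n.bodd :: l, ?_, ?_⟩
      · rw [binaryValue, hl, ← Nat.div2_val, Nat.bit_bodd_div2]
      · rw [List.length_cons, Nat.log_of_one_lt_of_le one_lt_two h]
        omega

/-! ### Running times of stack machines -/

section Machines

open Turing Turing.TM2.Stmt

/-- The machine `m` gets from the configuration `c` to `c'` in at most `n` steps. -/
def RunsWithin {K Λ σ : Type} [DecidableEq K] {Γ : K → Type} (m : Λ → TM2.Stmt Γ Λ σ) (n : ℕ)
    (c c' : TM2.Cfg Γ Λ σ) : Prop :=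
  ∃ k ≤ n, (flip bind (TM2.step m))^[k] (some c) = some c'

namespace RunsWithin

variable {K Λ σ : Type} [DecidableEq K] {Γ : K → Type} {m : Λ → TM2.Stmt Γ Λ σ}

theorem head {n : ℕ} {c c' c'' : TM2.Cfg Γ Λ σ} (h : TM2.step m c = some c')
    (h' : RunsWithin m n c' c'') : RunsWithin m (n + 1) c c'' := by
  obtain ⟨k, hk, hr⟩ := h'
  refine ⟨k + 1, by omega, ?_⟩
  rw [Function.iterate_succ_apply, ← hr]
  exact congrArg _ h

theorem single {c c' : TM2.Cfg Γ Λ σ} (h : TM2.step m c = some c') : RunsWithin m 1 c c' :=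
  head h ⟨0, le_rfl, rfl⟩

theorem mono {n n' : ℕ} {c c' : TM2.Cfg Γ Λ σ} (h : RunsWithin m n c c') (hn : n ≤ n') :
    RunsWithin m n' c c' :=
  h.imp fun _ hk => ⟨hk.1.trans hn, hk.2⟩

theorem trans {n n' : ℕ} {c c' c'' : TM2.Cfg Γ Λ σ} (h : RunsWithin m n c c')
    (h' : RunsWithin m n' c' c'') : RunsWithin m (n + n') c c'' := by
  obtain ⟨k, hk, hr⟩ := h
  obtain ⟨k', hk', hr'⟩ := h'
  refine ⟨k' + k, by omega, ?_⟩
  rw [Function.iterate_add_apply, hr, hr']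

theorem nonempty_outputsInTime {tm : FinTM2} {l : List (tm.Γ tm.k₀)} {l' : List (tm.Γ tm.k₁)}
    {n : ℕ} (h : RunsWithin tm.m n (initList tm l) (haltList tm l')) :
    Nonempty (TM2OutputsInTime tm l (some l') n) := by
  obtain ⟨k, hk, hr⟩ := h
  exact ⟨⟨⟨k, hr⟩, hk⟩⟩

end RunsWithin

/-! ### The decoder -/

/-- The decoder reads the flow off the data sublabel of the third label. -/
def valueDecoder (_ _ L : Label) : ℕ := binaryValue L.data.reverse

namespace ValueDecoder

/-- The stack alphabets: `false` is the input and `true` the output. -/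
abbrev Alphabet : Bool → Type
  | false => Option Bool
  | true => Bool

/-- The stacks with the given contents. -/
def contents (i : List (Option Bool)) (o : List Bool) : ∀ k, List (Alphabet k)
  | false => i
  | true => o

@[simp] theorem contents_false (i o) : contents i o false = i := rfl
@[simp] theorem contents_true (i o) : contents i o true = o := rfl

@[simp] theorem update_contents_false (i o i') :
    Function.update (contents i o) false i' = contents i' o := by
  funext k; cases k <;> rfl

@[simp] theorem update_contents_true (i o o') :
    Function.update (contents i o) true o' = contents i o' := by
  funext k; cases k <;> rfl

/-- The label `l < 5` stands for skipping the `l`-th sublabel, and `5` for copying the rest. -/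
def program (l : Fin 6) : TM2.Stmt Alphabet (Fin 6) (Option (Option Bool)) :=
  if l = 5 then
    pop false (fun _ s => s) <|
    branch (fun v => v == some none) (load (fun _ => none) halt) <|
    push true (fun v => v.join.getD false) <|
    goto fun _ => 5
  else
    pop false (fun _ s => s) <|
    branch (fun v => v == some none)
      (if l = 4 then push true (fun _ => true) (goto fun _ => 5) else goto fun _ => l + 1)
      (goto fun _ => l)

/-- Leaving the third index sublabel pushes the implicit leading digit, which becomes the bottom of
the output stack. -/
theorem runs_skip (l : Fin 6) (hl : l ≠ 5) (s : List Bool) (v r o) :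
    RunsWithin program (s.length + 1) ⟨some l, v, contents (s.map some ++ none :: r) o⟩
      ⟨some (l + 1), some none, contents r (if l = 4 then true :: o else o)⟩ := by
  induction s generalizing v with
  | nil =>
    apply RunsWithin.single
    by_cases h4 : l = 4
    · subst h4; simp [program]
    · simp [program, hl, h4]
  | cons b s ih =>
    refine RunsWithin.head ?_ (ih (some (some b)))
    simp [program, hl]

/-- Moving symbols between stacks reverses them, which is why data sublabels store their digits in
reverse. -/
theorem runs_copy (s : List Bool) (v o) :
    RunsWithin program (s.length + 1) ⟨some 5, v, contents (s.map some ++ [none]) o⟩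
      ⟨none, none, contents [] (s.reverse ++ o)⟩ := by
  induction s generalizing v o with
  | nil => exact RunsWithin.single (by simp [program])
  | cons b s ih =>
    refine RunsWithin.head (c' := ⟨some 5, some (some b), contents (s.map some ++ [none]) (b :: o)⟩)
      (by simp [program]) ?_
    simpa using ih (some (some b)) (b :: o)

/-- The machine that computes the decoder. -/
def machine : FinTM2 where
  K := Bool
  k₀ := false
  k₁ := true
  Γ := Alphabet
  Λ := Fin 6
  main := 0
  σ := Option (Option Bool)
  initialState := none
  Γk₀Fin := inferInstanceAs (Fintype (Option Bool))
  m := program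

theorem runs (L₁ L₂ L₃ : Label) :
    RunsWithin program (encodeLabels [L₁, L₂, L₃]).length
      ⟨some 0, none, contents (encodeLabels [L₁, L₂, L₃]) []⟩
      ⟨none, none, contents [] (Computability.encodeNat (valueDecoder L₁ L₂ L₃))⟩ := by
  have h := (((((runs_skip 0 (by decide) L₁.index none _ []).trans
    (runs_skip 1 (by decide) L₁.data _ _ _)).trans
    (runs_skip 2 (by decide) L₂.index _ _ _)).trans
    (runs_skip 3 (by decide) L₂.data _ _ _)).trans
    (runs_skip 4 (by decide) L₃.index _ _ _)).trans
    (runs_copy L₃.data _ _)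
  rw [valueDecoder, encodeNat_binaryValue]
  have he : encodeLabels [L₁, L₂, L₃] = L₁.index.map some ++ none :: (L₁.data.map some ++ none ::
      (L₂.index.map some ++ none :: (L₂.data.map some ++ none ::
      (L₃.index.map some ++ none :: (L₃.data.map some ++ [none]))))) := by
    simp [encodeLabels]
  rw [he]
  refine RunsWithin.mono h ?_
  simp only [List.length_append, List.length_cons, List.length_map, List.length_nil]
  omega

end ValueDecoder

theorem polyTimeDecoder_valueDecoder : PolyTimeDecoder valueDecoder := by
  have h : ∀ p : Label × Label × Label, Nonempty (TM2OutputsInTime ValueDecoder.machine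
      ((encodeLabels [p.1, p.2.1, p.2.2]).map (Equiv.refl (Option Bool)).invFun)
      (some ((Computability.encodeNat (valueDecoder p.1 p.2.1 p.2.2)).map (Equiv.refl Bool).invFun))
      ((Polynomial.X : Polynomial ℕ).eval (encodeLabels [p.1, p.2.1, p.2.2]).length)) := fun p => by
    apply RunsWithin.nonempty_outputsInTime
    rw [Polynomial.eval_X]
    have hi : initList ValueDecoder.machine ((encodeLabels [p.1, p.2.1, p.2.2]).map (Equiv.refl (Option Bool)).invFun) =
        ⟨some (0 : Fin 6), none, ValueDecoder.contents (encodeLabels [p.1, p.2.1, p.2.2]) []⟩ := by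
      refine congrArg (TM2.Cfg.mk _ _) (funext fun k => ?_)
      cases k <;> first | exact List.map_id _ | rfl
    have ho : haltList ValueDecoder.machine ((Computability.encodeNat (valueDecoder p.1 p.2.1 p.2.2)).map (Equiv.refl Bool).invFun) =
        ⟨none, none, ValueDecoder.contents [] (Computability.encodeNat (valueDecoder p.1 p.2.1 p.2.2))⟩ := by
      refine congrArg (TM2.Cfg.mk _ _) (funext fun k => ?_)
      cases k <;> first | exact List.map_id _ | rfl
    rw [hi, ho]
    exact ValueDecoder.runs p.1 p.2.1 p.2.2
  exact ⟨⟨⟨ValueDecoder.machine, Equiv.refl (Option Bool), Equiv.refl Bool⟩, Polynomial.X,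
    fun p => (h p).some⟩⟩

/-! ### The query algorithm -/

/-- The query algorithm computes the meeting node of the two addresses; index sublabels are
reversed addresses. -/
def meetQuery (L₁ L₂ : Label) : List Bool :=
  (meet false L₁.index.reverse L₂.index.reverse).reverse

namespace MeetQuery

/-- The stacks of the machine. -/
inductive Stack
  | input | left | right | output
  deriving DecidableEq

instance : Fintype Stack :=
  ⟨{.input, .left, .right, .output}, fun k => by cases k <;> decide⟩

/-- The function labels of the machine. -/
inductive Phase
  | loadLeft | skipLeft | loadRight | skipRight | compare (mid : Bool) | copyLeft (mid : Bool)
  | copyRight (mid : Bool) | clear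
  deriving Fintype

/-- The stack alphabets. -/
abbrev Alphabet : Stack → Type
  | .input => Option Bool
  | .left => Bool
  | .right => Bool
  | .output => Bool

/-- The last symbols read from the input, the left and the right stack. -/
abbrev Memory : Type := Option (Option Bool) × Option Bool × Option Bool

/-- The stacks with the given contents. -/
def contents (i : List (Option Bool)) (a b o : List Bool) : ∀ k, List (Alphabet k)
  | .input => i
  | .left => a
  | .right => b
  | .output => o

@[simp] theorem contents_input (i a b o) : contents i a b o .input = i := rfl
@[simp] theorem contents_left (i a b o) : contents i a b o .left = a := rfl
@[simp] theorem contents_right (i a b o) : contents i a b o .right = b := rfl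
@[simp] theorem contents_output (i a b o) : contents i a b o .output = o := rfl

@[simp] theorem update_contents_input (i a b o i') :
    Function.update (contents i a b o) .input i' = contents i' a b o := by
  funext k; cases k <;> rfl

@[simp] theorem update_contents_left (i a b o a') :
    Function.update (contents i a b o) .left a' = contents i a' b o := by
  funext k; cases k <;> rfl

@[simp] theorem update_contents_right (i a b o b') :
    Function.update (contents i a b o) .right b' = contents i a b' o := by
  funext k; cases k <;> rfl

@[simp] theorem update_contents_output (i a b o o') :
    Function.update (contents i a b o) .output o' = contents i a b o' := by
  funext k; cases k <;> rfl

/-- The phase after the bit `c` of the winning address has been copied. -/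
def next (copy : Bool → Phase) (mid c : Bool) : Phase :=
  if mid && c then .clear else copy (!mid && !c)

/-- The program of the machine. -/
def program : Phase → TM2.Stmt Alphabet Phase Memory
  | .loadLeft =>
    pop .input (fun v s => (s, v.2)) <|
    branch (fun v => v.1 == some none) (goto fun _ => .skipLeft) <|
    push .left (fun v => v.1.join.getD false) <|
    goto fun _ => .loadLeft
  | .skipLeft =>
    pop .input (fun v s => (s, v.2)) <|
    branch (fun v => v.1 == some none) (goto fun _ => .loadRight) <|
    goto fun _ => .skipLeft
  | .loadRight =>
    pop .input (fun v s => (s, v.2)) <|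
    branch (fun v => v.1 == some none) (goto fun _ => .skipRight) <|
    push .right (fun v => v.1.join.getD false) <|
    goto fun _ => .loadRight
  | .skipRight =>
    pop .input (fun v s => (s, v.2)) <|
    branch (fun v => v.1 == some none) (goto fun _ => .compare false) <|
    goto fun _ => .skipRight
  | .compare mid =>
    pop .left (fun v s => (v.1, s, v.2.2)) <|
    pop .right (fun v s => (v.1, v.2.1, s)) <|
    branch (fun v => v.2.1 == none && v.2.2 == none) (load (fun _ => (none, none, none)) halt) <|
    branch (fun v => v.2.1 == v.2.2)
      (push .output (fun v => v.2.1.getD false) <|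
        goto fun v => .compare (!mid && !v.2.1.getD false)) <|
    branch (fun v => v.2.1 == some false || v.2.2 == none)
      (push .output (fun v => v.2.1.getD false) <|
        goto fun v => next .copyLeft mid (v.2.1.getD false)) <|
    push .output (fun v => v.2.2.getD false) <|
    goto fun v => next .copyRight mid (v.2.2.getD false)
  | .copyLeft mid =>
    pop .left (fun v s => (v.1, s, v.2.2)) <|
    branch (fun v => v.2.1 == none) (goto fun _ => .clear) <|
    push .output (fun v => v.2.1.getD false) <|
    goto fun v => next .copyLeft mid (v.2.1.getD false)
  | .copyRight mid =>
    pop .right (fun v s => (v.1, v.2.1, s)) <|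
    branch (fun v => v.2.2 == none) (goto fun _ => .clear) <|
    push .output (fun v => v.2.2.getD false) <|
    goto fun v => next .copyRight mid (v.2.2.getD false)
  | .clear =>
    pop .left (fun v s => (v.1, s, v.2.2)) <|
    pop .right (fun v s => (v.1, v.2.1, s)) <|
    branch (fun v => v.2.1 == none && v.2.2 == none) (load (fun _ => (none, none, none)) halt) <|
    goto fun _ => .clear

theorem runs_loadLeft (s : List Bool) (v r a b o) :
    RunsWithin program (s.length + 1)
      ⟨some .loadLeft, v, contents (s.map some ++ none :: r) a b o⟩
      ⟨some .skipLeft, (some none, v.2), contents r (s.reverse ++ a) b o⟩ := by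
  induction s generalizing v a with
  | nil => exact RunsWithin.single (by simp [program])
  | cons c s ih =>
    refine RunsWithin.head (c' := ⟨some .loadLeft, (some (some c), v.2),
      contents (s.map some ++ none :: r) (c :: a) b o⟩) (by simp [program]) ?_
    simpa using ih (some (some c), v.2) (c :: a)

theorem runs_skipLeft (s : List Bool) (v r a b o) :
    RunsWithin program (s.length + 1)
      ⟨some .skipLeft, v, contents (s.map some ++ none :: r) a b o⟩
      ⟨some .loadRight, (some none, v.2), contents r a b o⟩ := by
  induction s generalizing v with
  | nil => exact RunsWithin.single (by simp [program])
  | cons c s ih =>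
    refine RunsWithin.head (c' := ⟨some .skipLeft, (some (some c), v.2),
      contents (s.map some ++ none :: r) a b o⟩) (by simp [program]) ?_
    exact ih (some (some c), v.2)

theorem runs_loadRight (s : List Bool) (v r a b o) :
    RunsWithin program (s.length + 1)
      ⟨some .loadRight, v, contents (s.map some ++ none :: r) a b o⟩
      ⟨some .skipRight, (some none, v.2), contents r a (s.reverse ++ b) o⟩ := by
  induction s generalizing v b with
  | nil => exact RunsWithin.single (by simp [program])
  | cons c s ih =>
    refine RunsWithin.head (c' := ⟨some .loadRight, (some (some c), v.2),
      contents (s.map some ++ none :: r) a (c :: b) o⟩) (by simp [program]) ?_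
    simpa using ih (some (some c), v.2) (c :: b)

theorem runs_skipRight (s : List Bool) (v r a b o) :
    RunsWithin program (s.length + 1)
      ⟨some .skipRight, v, contents (s.map some ++ none :: r) a b o⟩
      ⟨some (.compare false), (some none, v.2), contents r a b o⟩ := by
  induction s generalizing v with
  | nil => exact RunsWithin.single (by simp [program])
  | cons c s ih =>
    refine RunsWithin.head (c' := ⟨some .skipRight, (some (some c), v.2),
      contents (s.map some ++ none :: r) a b o⟩) (by simp [program]) ?_
    exact ih (some (some c), v.2)

/-- A proper halting configuration has all stacks but the output empty and the memory reset. -/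
theorem runs_clear (a b : List Bool) (v o) :
    RunsWithin program (a.length + b.length + 1) ⟨some .clear, v, contents [] a b o⟩
      ⟨none, (none, none, none), contents [] [] [] o⟩ := by
  induction hn : a.length + b.length using Nat.strong_induction_on generalizing a b v with
  | _ n ih =>
    subst hn
    by_cases h : a = [] ∧ b = []
    · obtain ⟨rfl, rfl⟩ := h
      exact RunsWithin.single (by simp [program])
    · have hlt : a.tail.length + b.tail.length < a.length + b.length := by
        cases a <;> cases b <;> simp_all; omega
      refine RunsWithin.mono (RunsWithin.head ?_ (ih _ hlt a.tail b.tail (v.1, a.head?, b.head?)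
        rfl)) (by omega)
      cases a <;> cases b <;> simp_all [program]

theorem runs_copyLeft (mid : Bool) (a b : List Bool) (v o) :
    RunsWithin program (a.length + b.length + 2) ⟨some (.copyLeft mid), v, contents [] a b o⟩
      ⟨none, (none, none, none), contents [] [] [] ((finish mid a).reverse ++ o)⟩ := by
  induction a generalizing mid v o with
  | nil =>
    refine RunsWithin.mono (RunsWithin.head ?_ (runs_clear [] b (v.1, none, v.2.2) o)) (by simp)
    simp [program]
  | cons c a ih =>
    have hs : TM2.step program ⟨some (.copyLeft mid), v, contents [] (c :: a) b o⟩ =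
        some ⟨some (next .copyLeft mid c), (v.1, some c, v.2.2), contents [] a b (c :: o)⟩ := by
      simp [program]
    by_cases h : (mid && c) = true
    · rw [next, if_pos h] at hs
      rw [finish, if_pos h]
      refine RunsWithin.mono (RunsWithin.head hs (runs_clear a b _ _)) ?_
      simp only [List.length_cons]; omega
    · rw [next, if_neg h] at hs
      rw [finish, if_neg h, List.reverse_cons, List.append_assoc]
      refine RunsWithin.mono (RunsWithin.head hs (ih _ _ _)) ?_
      simp only [List.length_cons]; omega

theorem runs_copyRight (mid : Bool) (a b : List Bool) (v o) :
    RunsWithin program (a.length + b.length + 2) ⟨some (.copyRight mid), v, contents [] a b o⟩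
      ⟨none, (none, none, none), contents [] [] [] ((finish mid b).reverse ++ o)⟩ := by
  induction b generalizing mid v o with
  | nil =>
    refine RunsWithin.mono (RunsWithin.head ?_ (runs_clear a [] (v.1, v.2.1, none) o)) (by simp)
    simp [program]
  | cons c b ih =>
    have hs : TM2.step program ⟨some (.copyRight mid), v, contents [] a (c :: b) o⟩ =
        some ⟨some (next .copyRight mid c), (v.1, v.2.1, some c), contents [] a b (c :: o)⟩ := by
      simp [program]
    by_cases h : (mid && c) = true
    · rw [next, if_pos h] at hs
      rw [finish, if_pos h]
      refine RunsWithin.mono (RunsWithin.head hs (runs_clear a b _ _)) ?_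
      simp only [List.length_cons]; omega
    · rw [next, if_neg h] at hs
      rw [finish, if_neg h, List.reverse_cons, List.append_assoc]
      refine RunsWithin.mono (RunsWithin.head hs (ih _ _ _)) ?_
      simp only [List.length_cons]; omega

/-- Copying the first bit of the winner in the comparing phase is like copying it afterwards. -/
theorem runs_next_copyLeft (mid c : Bool) (a b : List Bool) (v o) :
    RunsWithin program (a.length + b.length + 2)
      ⟨some (next .copyLeft mid c), v, contents [] a b (c :: o)⟩
      ⟨none, (none, none, none), contents [] [] [] ((finish mid (c :: a)).reverse ++ o)⟩ := by
  by_cases h : (mid && c) = true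
  · rw [next, finish, if_pos h, if_pos h]
    exact (runs_clear a b _ _).mono (by omega)
  · rw [next, finish, if_neg h, if_neg h, List.reverse_cons, List.append_assoc]
    exact runs_copyLeft _ a b _ _

theorem runs_next_copyRight (mid c : Bool) (a b : List Bool) (v o) :
    RunsWithin program (a.length + b.length + 2)
      ⟨some (next .copyRight mid c), v, contents [] a b (c :: o)⟩
      ⟨none, (none, none, none), contents [] [] [] ((finish mid (c :: b)).reverse ++ o)⟩ := by
  by_cases h : (mid && c) = true
  · rw [next, finish, if_pos h, if_pos h]
    exact (runs_clear a b _ _).mono (by omega)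
  · rw [next, finish, if_neg h, if_neg h, List.reverse_cons, List.append_assoc]
    exact runs_copyRight _ a b _ _

/-- The phases follow the recursion of `meet` and `finish` bit by bit; the time bound includes
clearing what remains of both addresses. -/
theorem runs_compare (mid : Bool) (a b : List Bool) (v o) :
    RunsWithin program (a.length + b.length + 2) ⟨some (.compare mid), v, contents [] a b o⟩
      ⟨none, (none, none, none), contents [] [] [] ((meet mid a b).reverse ++ o)⟩ := by
  induction a generalizing mid b v o with
  | nil =>
    cases b with
    | nil => exact (RunsWithin.single (by simp [program, meet, finish])).mono (by omega)
    | cons y b =>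
      rw [meet]
      refine (RunsWithin.head ?_
        (runs_next_copyRight mid y [] b (v.1, none, some y) o)).mono (by simp)
      simp [program]
  | cons x a ih =>
    cases b with
    | nil =>
      rw [meet]
      refine (RunsWithin.head ?_
        (runs_next_copyLeft mid x a [] (v.1, some x, none) o)).mono (by simp)
      simp [program]
    | cons y b =>
      by_cases hxy : x = y
      · subst hxy
        rw [meet, if_pos rfl, List.reverse_cons, List.append_assoc]
        refine (RunsWithin.head ?_ (ih (!mid && !x) b (v.1, some x, some x) (x :: o))).mono
          (by simp only [List.length_cons]; omega)
        simp [program]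
      · rw [meet, if_neg hxy]
        by_cases hx : x = false
        · rw [if_pos hx]
          refine (RunsWithin.head ?_
            (runs_next_copyLeft mid x a b (v.1, some x, some y) o)).mono
              (by simp only [List.length_cons]; omega)
          cases x <;> cases y <;> simp_all [program]
        · rw [if_neg hx]
          refine (RunsWithin.head ?_
            (runs_next_copyRight mid y a b (v.1, some x, some y) o)).mono
              (by simp only [List.length_cons]; omega)
          cases x <;> cases y <;> simp_all [program]

/-- The machine that computes the query algorithm. -/
def machine : FinTM2 where
  K := Stack
  k₀ := .input
  k₁ := .output
  Γ := Alphabet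
  Λ := Phase
  main := .loadLeft
  σ := Memory
  initialState := (none, none, none)
  Γk₀Fin := inferInstanceAs (Fintype (Option Bool))
  m := program

/-- Every input symbol is read once, and every address bit is popped at most once more, whence the
factor 2. -/
theorem runs (L₁ L₂ : Label) :
    RunsWithin program (2 * (encodeLabels [L₁, L₂]).length)
      ⟨some .loadLeft, (none, none, none), contents (encodeLabels [L₁, L₂]) [] [] []⟩
      ⟨none, (none, none, none), contents [] [] [] (meetQuery L₁ L₂)⟩ := by
  have h := ((((runs_loadLeft L₁.index (none, none, none) _ [] [] []).trans
    (runs_skipLeft L₁.data _ _ _ _ _)).trans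
    (runs_loadRight L₂.index _ _ _ _ _)).trans
    (runs_skipRight L₂.data _ [] _ _ _)).trans
    (runs_compare false _ _ _ _)
  have he : encodeLabels [L₁, L₂] = L₁.index.map some ++ none :: (L₁.data.map some ++ none ::
      (L₂.index.map some ++ none :: (L₂.data.map some ++ [none]))) := by
    simp [encodeLabels]
  rw [he]
  simp only [List.append_nil] at h
  refine RunsWithin.mono h ?_
  simp only [List.length_append, List.length_cons, List.length_map, List.length_nil,
    List.length_reverse]
  omega

end MeetQuery

theorem polyTimeQuery_meetQuery : PolyTimeQuery meetQuery := by
  have h : ∀ p : Label × Label, Nonempty (TM2OutputsInTime MeetQuery.machine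
      ((encodeLabels [p.1, p.2]).map (Equiv.refl (Option Bool)).invFun)
      (some ((meetQuery p.1 p.2).map (Equiv.refl Bool).invFun))
      ((2 * Polynomial.X : Polynomial ℕ).eval (encodeLabels [p.1, p.2]).length)) := fun p => by
    apply RunsWithin.nonempty_outputsInTime
    rw [Polynomial.eval_mul, Polynomial.eval_ofNat, Polynomial.eval_X]
    have hi : initList MeetQuery.machine ((encodeLabels [p.1, p.2]).map (Equiv.refl (Option Bool)).invFun) =
        ⟨some .loadLeft, (none, none, none), MeetQuery.contents (encodeLabels [p.1, p.2]) [] [] []⟩ := by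
      refine congrArg (TM2.Cfg.mk _ _) (funext fun k => ?_)
      cases k <;> first | exact List.map_id _ | rfl
    have ho : haltList MeetQuery.machine ((meetQuery p.1 p.2).map (Equiv.refl Bool).invFun) =
        ⟨none, (none, none, none), MeetQuery.contents [] [] [] (meetQuery p.1 p.2)⟩ := by
      refine congrArg (TM2.Cfg.mk _ _) (funext fun k => ?_)
      cases k <;> first | exact List.map_id _ | rfl
    rw [hi, ho]
    exact MeetQuery.runs p.1 p.2
  exact ⟨⟨⟨MeetQuery.machine, Equiv.refl (Option Bool), Equiv.refl Bool⟩, 2 * Polynomial.X,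
    fun p => (h p).some⟩⟩

end Machines

/-! ### The upper bound -/

theorem CapGraph.isSimilarity_flow {V : Type*} [Finite V] {W : ℕ} (G : CapGraph V W) :
    IsSimilarity G.flow :=
  ⟨fun _ _ huv => flow_comm huv, fun _ _ _ hux hxv huv => min_flow_le_flow hux hxv huv⟩

theorem CapGraph.exists_labels {n W : ℕ} (hn : 2 ≤ n) (hW : 1 ≤ W) (G : Family n W) :
    ∃ M : Fin n → Label, Function.Injective (fun v => (M v).index) ∧
      (∀ u v, u ≠ v → ∃ w, (M w).index = meetQuery (M u) (M v) ∧
        valueDecoder (M u) (M v) (M w) = G.flow u v) ∧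
      ∀ v, (M v).size ≤ 4 * Nat.log 2 n + Nat.log 2 (n ^ 2 * W) := by
  have : Nonempty (Fin n) := ⟨⟨0, by omega⟩⟩
  obtain ⟨x, addr, val, h⟩ := G.isSimilarity_flow.exists_addressing Finset.univ
    Finset.univ_nonempty
  have hpos : 0 < n ^ 2 * W := by positivity
  -- Nothing is known about the value at vertices that are never meeting points. Clamping bounds its
  -- length and leaves actual flows, which lie between 1 and n²W, unchanged.
  let clamp : ℕ → ℕ := fun k => max 1 (min k (n ^ 2 * W))
  have hclamp : ∀ k, 0 < clamp k ∧ clamp k ≤ n ^ 2 * W := fun k =>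
    ⟨lt_of_lt_of_le one_pos (le_max_left _ _), max_le hpos (min_le_right _ _)⟩
  choose bits hbits hlen using fun v => exists_binaryValue_eq (clamp (val v)) (hclamp _).1
  refine ⟨fun v => ⟨(addr v).reverse, (bits v).reverse⟩, ?_, ?_, ?_⟩
  · intro u v huv
    exact h.injOn (by simp) (by simp) (List.reverse_injective huv)
  · intro u v huv
    obtain ⟨w, -, -, hw1, hw2⟩ := h.meet u (by simp) v (by simp) huv
    refine ⟨w, by simp [meetQuery, hw1], ?_⟩
    have h1 : 1 ≤ G.flow u v := one_le_flow huv
    have h2 : G.flow u v ≤ n ^ 2 * W := by simpa using flow_le (G := G) huv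
    simp only [valueDecoder, List.reverse_reverse, hbits, hw2, clamp, min_eq_left h2,
      max_eq_right h1]
  · intro v
    have h1 := h.length_le v (by simp)
    rw [Finset.card_univ, Fintype.card_fin] at h1
    have h2 := (hlen v).trans (Nat.log_mono_right (hclamp (val v)).2)
    simp only [Label.size, List.length_reverse]
    omega

theorem exists_flowScheme {n W : ℕ} (hn : 2 ≤ n) (hW : 1 ≤ W) :
    ∃ S : FlowScheme n W, S.query = meetQuery ∧ S.decoder = valueDecoder ∧
      S.labelSize ≤ 4 * Nat.log 2 n + Nat.log 2 (n ^ 2 * W) := by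
  choose M hinj hcor hsize using fun G : Family n W => G.exists_labels hn hW
  exact ⟨⟨M, meetQuery, valueDecoder, hinj, hcor⟩, rfl, rfl, ciSup_le' fun p => hsize p.1 p.2⟩

/-! ### The lower bound -/

/-- The star with centre `0` and uniform capacities. -/
def star (n W : ℕ) [NeZero n] (k : ℕ) (hk : 0 < k) (hkW : k ≤ W) : Family n W where
  graph := SimpleGraph.fromRel fun a _ => a = 0
  connected := by
    have h : ∀ v : Fin n, (SimpleGraph.fromRel fun a _ : Fin n => a = 0).Reachable 0 v := by
      intro v
      by_cases hv : v = 0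
      · rw [hv]
      · exact SimpleGraph.Adj.reachable (by simp [Ne.symm hv])
    exact ⟨fun u v => (h u).symm.trans (h v)⟩
  cap := open Classical in fun e =>
    if e ∈ (SimpleGraph.fromRel fun a _ : Fin n => a = 0).edgeSet then k else 0
  cap_pos_iff e := by
    split_ifs with h <;> simp [h, hk]
  cap_le e := by
    split_ifs
    · exact hkW
    · exact Nat.zero_le _

/-- A leaf has a single edge, so every linking set uses one of its k copies, and each copy alone is
a linking set. -/
theorem flow_star {n W : ℕ} [NeZero n] {k : ℕ} (hk : 0 < k) (hkW : k ≤ W) {v : Fin n}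
    (hv : v ≠ 0) : (star n W k hk hkW).flow v 0 = k := by
  have hmem : s(v, 0) ∈ (SimpleGraph.fromRel fun a _ : Fin n => a = 0).edgeSet := by
    simp [hv]
  have hcap : (star n W k hk hkW).cap s(v, 0) = k := if_pos hmem
  apply le_antisymm
  · obtain ⟨A, hA, hl⟩ := (CapGraph.le_flow_iff hv).1 (le_refl ((star n W k hk hkW).flow v 0))
    have he : ∀ i, ∃ j, (⟨s(v, 0), j⟩ : (star n W k hk hkW).UnitEdge) ∈ A i := by
      intro i
      rcases Relation.ReflTransGen.cases_head (hl i) with h | ⟨b, ⟨⟨e, j⟩, hj, he⟩, -⟩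
      · exact absurd h hv
      · obtain rfl : e = s(v, b) := he
        have hadj : (star n W k hk hkW).graph.Adj v b :=
          ((star n W k hk hkW).cap_pos_iff s(v, b)).1 (Nat.zero_lt_of_lt j.2)
        have hb : b = 0 := by
          simpa [hv] using ((SimpleGraph.fromRel_adj _ _ _).1 hadj).2
        subst hb
        exact ⟨j, hj⟩
    choose j hj using he
    have hinj : Function.Injective j := by
      intro a b hab
      by_contra hne
      exact Set.disjoint_left.1 (hA hne) (hj a) (hab ▸ hj b)
    simpa [hcap] using Fintype.card_le_of_injective j hinj
  · refine (CapGraph.le_flow_iff hv).2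
      ⟨fun i => {⟨s(v, 0), Fin.cast hcap.symm i⟩}, fun i j hij => ?_, fun i => ?_⟩
    · rw [Function.onFun, Set.disjoint_singleton]
      intro h
      exact hij (by simpa using h)
    · exact Relation.ReflTransGen.single ⟨_, rfl, rfl⟩

/-- Read with an implicit leading digit, bit strings of at most s bits become distinct numbers from
1 to 2^(s+1) − 1. -/
theorem OneQueryScheme.lt_two_pow {n W : ℕ} {f : Family n W → Fin n → Fin n → ℕ}
    (S : OneQueryScheme n W f) (hW : Nonempty (Family n W)) : n < 2 ^ (S.labelSize + 1) := by
  obtain ⟨G⟩ := hW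
  have hlt : ∀ v, binaryValue (S.marker G v).index < 2 ^ (S.labelSize + 1) := fun v =>
    (binaryValue_lt _).trans_le (Nat.pow_le_pow_right two_pos (Nat.succ_le_succ
      ((Nat.le_add_right _ _).trans (S.size_le_labelSize G v))))
  have hpos : ∀ l, 0 < binaryValue l := by
    intro l
    induction l with
    | nil => exact one_pos
    | cons b l ih => rw [binaryValue, Nat.bit_val]; omega
  have hmem : ∀ v ∈ (Finset.univ : Finset (Fin n)), binaryValue (S.marker G v).index ∈
      Finset.Ico 1 (2 ^ (S.labelSize + 1)) := fun v _ => Finset.mem_Ico.2 ⟨hpos _, hlt v⟩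
  have := Finset.card_le_card_of_injOn _ hmem
    ((binaryValue_injective.comp (S.index_injective G)).injOn)
  simp only [Finset.card_univ, Fintype.card_fin, Nat.card_Ico] at this
  have := Nat.two_pow_pos (S.labelSize + 1)
  omega

/-- The decoder recovers k from the labels of v, 0 and the queried vertex in the star of capacity k.
These are six bit strings, each with fewer than 2^(s+1) possibilities. -/
theorem FlowScheme.le_two_pow {n W : ℕ} (hn : 2 ≤ n) (S : FlowScheme n W) :
    W ≤ 2 ^ (6 * (S.labelSize + 1)) := by
  have : NeZero n := ⟨by omega⟩
  obtain ⟨v, hv⟩ : ∃ v : Fin n, v ≠ 0 := ⟨⟨1, by omega⟩, fun h => by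
    simpa using congrArg Fin.val h⟩
  let G : Fin W → Family n W := fun k => star n W (k + 1) (Nat.succ_pos _) k.2
  choose w hw1 hw2 using fun k => S.correct (G k) v 0 hv
  let code (l : List Bool) (h : l.length ≤ S.labelSize) : Fin (2 ^ (S.labelSize + 1)) :=
    ⟨binaryValue l, (binaryValue_lt l).trans_le
      (Nat.pow_le_pow_right two_pos (Nat.succ_le_succ h))⟩
  have hindex : ∀ k u, (S.marker (G k) u).index.length ≤ S.labelSize := fun k u =>
    (Nat.le_add_right _ _).trans (S.size_le_labelSize (G k) u)
  have hdata : ∀ k u, (S.marker (G k) u).data.length ≤ S.labelSize := fun k u =>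
    (Nat.le_add_left _ _).trans (S.size_le_labelSize (G k) u)
  let vertex : Fin W → Fin 3 → Fin n := fun k => ![v, 0, w k]
  let F : Fin W → Fin 3 → Fin (2 ^ (S.labelSize + 1)) × Fin (2 ^ (S.labelSize + 1)) :=
    fun k i => (code _ (hindex k (vertex k i)), code _ (hdata k (vertex k i)))
  have hF : Function.Injective F := by
    intro k k' hkk
    have hlab : ∀ i, S.marker (G k) (vertex k i) = S.marker (G k') (vertex k' i) := by
      intro i
      have h := congrFun hkk i
      have h1 := binaryValue_injective (congrArg (fun p => p.1.val) h)
      have h2 := binaryValue_injective (congrArg (fun p => p.2.val) h)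
      revert h1 h2
      generalize S.marker (G k) (vertex k i) = a
      generalize S.marker (G k') (vertex k' i) = b
      obtain ⟨a1, a2⟩ := a
      obtain ⟨b1, b2⟩ := b
      rintro rfl rfl
      rfl
    have e0 := hlab 0
    have e1 := hlab 1
    have e2 := hlab 2
    have h1 := hw2 k
    have h2 := hw2 k'
    simp only [vertex, Matrix.cons_val_zero, Matrix.cons_val_one, Matrix.cons_val] at e0 e1 e2
    rw [e0, e1, e2, h2, flow_star _ _ hv, flow_star _ _ hv] at h1
    exact Fin.ext (by omega)
  have := Fintype.card_le_of_injective F hF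
  simp only [Fintype.card_fin, Fintype.card_pi, Fintype.card_prod, Finset.prod_const,
    Finset.card_univ] at this
  refine this.trans_eq ?_
  rw [← pow_add, ← pow_mul]
  congr 1
  ring

end FlowLabeling

/-! ### Both bounds in terms of natural logarithms. -/

theorem mainTheorem1 :
    -- upper bound, with one pair of polynomial time algorithms serving all `n` and `W`
    (∃ (Q : FlowLabeling.Label → FlowLabeling.Label → List Bool)
        (D : FlowLabeling.Label → FlowLabeling.Label → FlowLabeling.Label → ℕ),
      FlowLabeling.PolyTimeQuery Q ∧ FlowLabeling.PolyTimeDecoder D ∧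
      ∃ C : ℝ, 0 < C ∧ ∀ n W : ℕ, 2 ≤ n → 1 ≤ W →
        ∃ S : FlowLabeling.FlowScheme n W, S.query = Q ∧ S.decoder = D ∧
          (S.labelSize : ℝ) ≤ C * (Real.log n + Real.log W)) ∧
    -- lower bound, for arbitrary schemes, whose algorithms may depend on `n` and `W`
    (∃ c : ℝ, 0 < c ∧ ∀ n W : ℕ, 2 ≤ n → 1 ≤ W →
      ∀ S : FlowLabeling.FlowScheme n W,
        c * (Real.log n + Real.log W) ≤ (S.labelSize : ℝ)) := by
  have hlog2 : 0 < Real.log 2 := Real.log_pos one_lt_two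
  constructor
  -- The 6 is 4 from the addresses plus 2 from the factor n² in the bound on the flow.
  · refine ⟨_, _, FlowLabeling.polyTimeQuery_meetQuery, FlowLabeling.polyTimeDecoder_valueDecoder,
      6 / Real.log 2, by positivity, fun n W hn hW => ?_⟩
    obtain ⟨S, hQ, hD, hS⟩ := FlowLabeling.exists_flowScheme hn hW
    refine ⟨S, hQ, hD, ?_⟩
    have hn' : (0 : ℝ) < n := by exact_mod_cast (by omega : 0 < n)
    have hW' : (1 : ℝ) ≤ W := by exact_mod_cast hW
    have h1 : (Nat.log 2 n : ℝ) * Real.log 2 ≤ Real.log n := by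
      rw [← Real.log_pow]
      exact Real.log_le_log (by positivity) (by exact_mod_cast Nat.pow_log_le_self 2 (by omega))
    have h2 : (Nat.log 2 (n ^ 2 * W) : ℝ) * Real.log 2 ≤ 2 * Real.log n + Real.log W := by
      have h3 : (2 : ℝ) * Real.log n + Real.log W = Real.log ((n : ℝ) ^ 2 * W) := by
        rw [Real.log_mul (by positivity) (by positivity), Real.log_pow]
        norm_num
      rw [← Real.log_pow, h3]
      exact Real.log_le_log (by positivity)
        (by exact_mod_cast Nat.pow_log_le_self 2 (by positivity))
    have h3 : (S.labelSize : ℝ) ≤ 4 * Nat.log 2 n + Nat.log 2 (n ^ 2 * W) := by exact_mod_cast hS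
    have h4 := Real.log_nonneg hW'
    rw [div_mul_eq_mul_div, le_div_iff₀ hlog2]
    nlinarith
  -- With s the label size, the two counts add up to log n + log W ≤ 7(s+1) log 2, and s + 1 ≤ 2s
  -- because s ≥ 1.
  · refine ⟨1 / (14 * Real.log 2), by positivity, fun n W hn hW S => ?_⟩
    have hne : NeZero n := ⟨by omega⟩
    have hn' : (0 : ℝ) < n := by exact_mod_cast (by omega : 0 < n)
    have hW' : (0 : ℝ) < W := by exact_mod_cast hW
    have h1 := S.lt_two_pow ⟨FlowLabeling.star n W 1 one_pos hW⟩
    have h2 := FlowLabeling.FlowScheme.le_two_pow hn S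
    -- Label size 0 would give n < 2.
    have h3 : 1 ≤ S.labelSize := by
      by_contra h
      have h0 : S.labelSize = 0 := by omega
      rw [h0] at h1
      omega
    have h4 : Real.log n ≤ (S.labelSize + 1 : ℕ) * Real.log 2 := by
      rw [← Real.log_pow]
      exact Real.log_le_log hn' (by exact_mod_cast h1.le)
    have h5 : Real.log W ≤ (6 * (S.labelSize + 1) : ℕ) * Real.log 2 := by
      rw [← Real.log_pow]
      exact Real.log_le_log hW' (by exact_mod_cast h2)
    have h6 : (1 : ℝ) ≤ S.labelSize := by exact_mod_cast h3
    push_cast at h4 h5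
    rw [one_div_mul_eq_div, div_le_iff₀ (by positivity)]
    nlinarith
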